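/- Consider dynamic programs over finite relational schemas $\tau_{\mathrm{in}}$ (input) and $\tau_{\mathrm{aux}}$ (auxiliary). Such a program consists of - for every auxiliary symbol $R\in\tau_{\mathrm{aux}}$ and every operation $o\in\{\mathrm{ins}_S,\mathrm{del}_S\mid S\in\tau_{\mathrm{in}}\}$, a first-order update formula $\phi^R_o(\vec x;\vec y)$ with equality over $\tau_{\mathrm{in}}\cup\tau_{\mathrm{aux}}$, where $\vec x$ and $\vec y$ have the arities of $S$ and $R$; - for every $R\in\tau_{\mathrm{aux}}$, a first-order initialization formula $\iota_R(\vec y)$ with equality over $\tau_{\mathrm{in}}$; - a query symbol $R_Q\in\tau_{\mathrm{aux}}$. Over a non-empty finite domain $D$ the program starts with the empty input database and the auxiliary relations defined by the formulas $\iota_R$. A modification $(o,\vec a)$, with $o\in\{\mathrm{ins}_S,\mathrm{del}_S\}$ and $\vec a$ a tuple over $D$ of the arity of $S$, inserts $\vec a$ into, or deletes it from, $S$, and simultaneously replaces every auxiliary relation $R$ by $\{\vec b\mid \mathcal S\models\phi^R_o(\vec a;\vec b)\}$, where $\mathcal S$ is the state before the modification. The program is *empty* if, for every non-empty finite domain and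 every finite sequence of modifications, the relation $R_Q$ is empty in the state that is reached. It is a $\mathrm{DynProp}(1\text{-in},1\text{-aux})$-program if all input and auxiliary relations have arity at most $1$ and all update formulas are quantifier-free (the initialization formulas may contain quantifiers). **Theorem.** The emptiness problem for $\mathrm{DynProp}(1\text{-in},1\text{-aux})$-programs is decidable: there is an algorithm that, given any such program, decides whether it is empty. -/

import Mathlib

/-! Dynamic programs with first-order update formulas, as finite syntactic objects.

A schema is a list `σ : List ℕ` of arities: its relation symbols are the numbers
`i < σ.length`, and symbol `i` has arity `σ[i]`. -/

namespace DynComplexity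

/-- First-order formulas with equality over two disjoint relational schemas, the input schema
(atoms `inp i args`) and the auxiliary schema (atoms `aux i args`).
Variables are natural numbers; `all x φ` is `∀ x, φ`. The other connectives and `∃` are
expressible as usual. -/
inductive Fml : Type where
  | falsum : Fml
  | equal (x y : ℕ) : Fml
  | inp (i : ℕ) (args : List ℕ) : Fml
  | aux (i : ℕ) (args : List ℕ) : Fml
  | imp (φ ψ : Fml) : Fml
  | all (x : ℕ) (φ : Fml) : Fml

namespace Fml

/-- Every atom uses a symbol of the input schema `σ` or of the auxiliary schema `τ`,
with the right number of arguments. -/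
def Over (σ τ : List ℕ) : Fml → Prop
  | falsum => True
  | equal _ _ => True
  | inp i args => σ[i]? = some args.length
  | aux i args => τ[i]? = some args.length
  | imp φ ψ => Over σ τ φ ∧ Over σ τ ψ
  | all _ φ => Over σ τ φ

/-- The free variables of a formula. -/
def freeVars : Fml → Finset ℕ
  | falsum => ∅
  | equal x y => {x, y}
  | inp _ args => args.toFinset
  | aux _ args => args.toFinset
  | imp φ ψ => freeVars φ ∪ freeVars ψ
  | all x φ => (freeVars φ).erase x

/-- The formula contains no quantifier. -/
def QuantifierFree : Fml → Prop
  | all _ _ => False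
  | imp φ ψ => QuantifierFree φ ∧ QuantifierFree ψ
  | _ => True

/-- A Gödel numbering of formulas. -/
def code : Fml → ℕ
  | falsum => 0
  | equal x y => 5 * Nat.pair x y + 1
  | inp i args => 5 * Nat.pair i (Encodable.encode args) + 2
  | aux i args => 5 * Nat.pair i (Encodable.encode args) + 3
  | imp φ ψ => 5 * Nat.pair φ.code ψ.code + 4
  | all x φ => 5 * Nat.pair x φ.code + 5

theorem code_injective : Function.Injective code := by
  intro φ
  induction φ with
  | falsum => intro ψ h; cases ψ <;> simp [code] at h ⊢
  | equal x y =>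
    intro ψ h
    cases ψ <;> simp only [code] at h <;> first | omega | skip
    have h' := Nat.pair_eq_pair.1 (Nat.eq_of_mul_eq_mul_left (by norm_num) (Nat.add_right_cancel h))
    rw [h'.1, h'.2]
  | inp i l =>
    intro ψ h
    cases ψ <;> simp only [code] at h <;> first | omega | skip
    have h' := Nat.pair_eq_pair.1 (Nat.eq_of_mul_eq_mul_left (by norm_num) (Nat.add_right_cancel h))
    rw [h'.1, Encodable.encode_injective h'.2]
  | aux i l =>
    intro ψ h
    cases ψ <;> simp only [code] at h <;> first | omega | skip
    have h' := Nat.pair_eq_pair.1 (Nat.eq_of_mul_eq_mul_left (by norm_num) (Nat.add_right_cancel h))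
    rw [h'.1, Encodable.encode_injective h'.2]
  | imp φ₁ φ₂ ih₁ ih₂ =>
    intro ψ h
    cases ψ <;> simp only [code] at h <;> first | omega | skip
    have h' := Nat.pair_eq_pair.1 (Nat.eq_of_mul_eq_mul_left (by norm_num) (Nat.add_right_cancel h))
    rw [ih₁ h'.1, ih₂ h'.2]
  | all x φ ih =>
    intro ψ h
    cases ψ <;> simp only [code] at h <;> first | omega | skip
    have h' := Nat.pair_eq_pair.1 (Nat.eq_of_mul_eq_mul_left (by norm_num) (Nat.add_right_cancel h))
    rw [h'.1, ih h'.2]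

theorem code_surjective : Function.Surjective code := by
  intro n
  induction n using Nat.strong_induction_on with
  | _ n ih =>
    rcases Nat.eq_zero_or_pos n with rfl | hn
    · exact ⟨falsum, rfl⟩
    · obtain ⟨m, hm⟩ : ∃ m, m = (n - 1) / 5 := ⟨_, rfl⟩
      have hp := Nat.pair_unpair m
      have h1 := Nat.unpair_left_le m
      have h2 := Nat.unpair_right_le m
      have hl : Encodable.encode (Denumerable.ofNat (List ℕ) m.unpair.2) = m.unpair.2 :=
        Denumerable.encode_ofNat _
      have hc : n = 5 * m + 1 ∨ n = 5 * m + 2 ∨ n = 5 * m + 3 ∨ n = 5 * m + 4 ∨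
          n = 5 * m + 5 := by omega
      rcases hc with h | h | h | h | h
      · exact ⟨equal m.unpair.1 m.unpair.2, by simp only [code, hp]; omega⟩
      · exact ⟨inp m.unpair.1 (Denumerable.ofNat (List ℕ) m.unpair.2), by
          simp only [code, hl, hp]; omega⟩
      · exact ⟨aux m.unpair.1 (Denumerable.ofNat (List ℕ) m.unpair.2), by
          simp only [code, hl, hp]; omega⟩
      · obtain ⟨φ, hφ⟩ := ih m.unpair.1 (by omega)
        obtain ⟨ψ, hψ⟩ := ih m.unpair.2 (by omega)
        exact ⟨imp φ ψ, by simp only [code, hφ, hψ, hp]; omega⟩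
      · obtain ⟨φ, hφ⟩ := ih m.unpair.2 (by omega)
        exact ⟨all m.unpair.1 φ, by simp only [code, hφ, hp]; omega⟩

/-- The Gödel numbering makes formulas a legitimate input type for algorithms. -/
noncomputable instance : Primcodable Fml :=
  Primcodable.ofEquiv ℕ (Equiv.ofBijective code ⟨code_injective, code_surjective⟩)

end Fml

/-- A database with domain `D`: a relation is the set of its tuples, written as lists. -/
abbrev Database (D : Type) : Type := ℕ → Set (List D)

/-- A program state with domain `D`: an input database and an auxiliary database. -/
structure State (D : Type) : Type where
  inputDB : Database D
  auxDB : Database D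

/-- Truth of a formula in a state under a variable assignment. -/
def Fml.Holds {D : Type} (𝒮 : State D) : (ℕ → D) → Fml → Prop
  | _, .falsum => False
  | v, .equal x y => v x = v y
  | v, .inp i args => args.map v ∈ 𝒮.inputDB i
  | v, .aux i args => args.map v ∈ 𝒮.auxDB i
  | v, .imp φ ψ => Fml.Holds 𝒮 v φ → Fml.Holds 𝒮 v ψ
  | v, .all x φ => ∀ d : D, Fml.Holds 𝒮 (Function.update v x d) φ

/-- `𝒮 ⊨ φ(c)`: the variable `i` is mapped to the `i`-th entry of the tuple `c`.
(The value given to variables `i ≥ c.length` is irrelevant, since they will not occur freely.) -/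
def Fml.Sat {D : Type} [Nonempty D] (𝒮 : State D) (φ : Fml) (c : List D) : Prop :=
  φ.Holds 𝒮 fun i => c.getD i (Classical.arbitrary D)

/-- The two kinds of operations on an input relation. -/
inductive OpKind : Type where
  | ins : OpKind
  | del : OpKind

/-- A modification: insert `tuple` into, or delete it from, the input relation `symb`. -/
structure Modification (D : Type) : Type where
  kind : OpKind
  symb : ℕ
  tuple : List D

/-- The database resulting from a modification. -/
def Modification.apply {D : Type} (δ : Modification D) (I : Database D) : Database D :=
  Function.update I δ.symb <|
    match δ.kind with
    | .ins => I δ.symb ∪ {δ.tuple}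
    | .del => I δ.symb \ {δ.tuple}

/-- A dynamic program with first-order update formulas and first-order initialization, as raw data
(see `DynProgram.WellFormed` for the side conditions):
* `inAr`, `auxAr`: the arities of the input and of the auxiliary relation symbols;
* `insFml[S][R]`, `delFml[S][R]`: the update formula of the auxiliary symbol `R` for insertions
  into and deletions from the input relation `S`. If `S` has arity `k` and `R` arity `m`, its
  variables `0, …, k - 1` stand for the modified tuple and `k, …, k + m - 1` for the tuple
  whose membership in the updated `R` is defined;
* `initFml[R]`: the formula over the input schema that defines the initial value of `R`;
* `query`: the query symbol, an auxiliary symbol. -/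
structure DynProgram : Type where
  inAr : List ℕ
  auxAr : List ℕ
  insFml : List (List Fml)
  delFml : List (List Fml)
  initFml : List Fml
  query : ℕ

namespace DynProgram

/-- A program is the tuple of its components. -/
def equivProd : DynProgram ≃
    List ℕ × List ℕ × List (List Fml) × List (List Fml) × List Fml × ℕ where
  toFun P := (P.inAr, P.auxAr, P.insFml, P.delFml, P.initFml, P.query)
  invFun p := ⟨p.1, p.2.1, p.2.2.1, p.2.2.2.1, p.2.2.2.2.1, p.2.2.2.2.2⟩
  left_inv _ := rfl
  right_inv _ := rfl

noncomputable instance : Primcodable DynProgram :=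
  Primcodable.ofEquiv _ equivProd

/-- The update formula of the auxiliary symbol `R` for the operation `o` on the input symbol `S`. -/
def updateFml (P : DynProgram) (o : OpKind) (S R : ℕ) : Fml :=
  match o with
  | .ins => (P.insFml.getD S []).getD R .falsum
  | .del => (P.delFml.getD S []).getD R .falsum

/-- The initialization formula of the auxiliary symbol `R`. -/
def initFormula (P : DynProgram) (R : ℕ) : Fml :=
  P.initFml.getD R .falsum

/-- The raw data is a dynamic program: there is exactly one update formula for each operation and
each auxiliary symbol, and one initialization formula for each auxiliary symbol; update formulas
are over the union of both schemas, initialization formulas over the input schema only, their free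
variables are those that stand for the tuples, and the query symbol is an auxiliary symbol. -/
structure WellFormed (P : DynProgram) : Prop where
  insFml_length : P.insFml.length = P.inAr.length
  insFml_row : ∀ l ∈ P.insFml, l.length = P.auxAr.length
  delFml_length : P.delFml.length = P.inAr.length
  delFml_row : ∀ l ∈ P.delFml, l.length = P.auxAr.length
  initFml_length : P.initFml.length = P.auxAr.length
  query_lt : P.query < P.auxAr.length
  update_over : ∀ o, ∀ S < P.inAr.length, ∀ R < P.auxAr.length,
    (P.updateFml o S R).Over P.inAr P.auxAr
  update_freeVars : ∀ o, ∀ S (hS : S < P.inAr.length), ∀ R (hR : R < P.auxAr.length),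
    ∀ x ∈ (P.updateFml o S R).freeVars, x < P.inAr[S] + P.auxAr[R]
  init_over : ∀ R < P.auxAr.length, (P.initFormula R).Over P.inAr []
  init_freeVars : ∀ R (hR : R < P.auxAr.length),
    ∀ x ∈ (P.initFormula R).freeVars, x < P.auxAr[R]

/-- `P` is a `DynProp`-program with at most `ℓ`-ary input and at most `m`-ary auxiliary relations:
all update formulas are quantifier-free. (Initialization formulas may have quantifiers.) -/
structure IsDynProp (ℓ m : ℕ) (P : DynProgram) : Prop where
  wellFormed : P.WellFormed
  inAr_le : ∀ k ∈ P.inAr, k ≤ ℓ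
  auxAr_le : ∀ k ∈ P.auxAr, k ≤ m
  quantifierFree : ∀ o, ∀ S < P.inAr.length, ∀ R < P.auxAr.length,
    (P.updateFml o S R).QuantifierFree

section Semantics

variable {D : Type} [Nonempty D]

/-- The initial state for an input database. -/
def initState (P : DynProgram) (I : Database D) : State D where
  inputDB := I
  auxDB R := {b | P.auxAr[R]? = some b.length ∧ (P.initFormula R).Sat ⟨I, fun _ => ∅⟩ b}

/-- The state resulting from one modification: all update formulas are evaluated in the old
state. -/
def step (P : DynProgram) (𝒮 : State D) (δ : Modification D) : State D where
  inputDB := δ.apply 𝒮.inputDB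
  auxDB R := {b | P.auxAr[R]? = some b.length ∧
    (P.updateFml δ.kind δ.symb R).Sat 𝒮 (δ.tuple ++ b)}

/-- The modification concerns an input relation of `P` and has a tuple of the right arity. -/
def Admissible (P : DynProgram) (δ : Modification D) : Prop :=
  P.inAr[δ.symb]? = some δ.tuple.length

/-- The state reached by the modification sequence `α` from the empty input database. -/
def reach (P : DynProgram) (α : List (Modification D)) : State D :=
  α.foldl P.step (P.initState fun _ => ∅)

end Semantics

/-- `P` is empty: for every non-empty finite domain, no modification sequence leads from the empty
input database to a state with non-empty query relation. -/
def IsEmpty (P : DynProgram) : Prop :=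
  ∀ (D : Type) [Finite D] [Nonempty D] (α : List (Modification D)),
    (∀ δ ∈ α, P.Admissible δ) → (P.reach α).auxDB P.query = ∅

end DynProgram

end DynComplexity

/-! Update formulas are quantifier-free and all relations are at most unary, so after a modification
at `a` the new status of an element `b` depends only on the nullary truth values, on the colours
(unary truth values) of `a` and `b`, and on whether `a = b`. Up to isomorphism a state is a global
colour together with a word of colours, one letter per element. A program thus becomes a transfer
net: a step picks a letter, recolours it, and recolours all other letters by one common function.
Emptiness says that no initial word, one for each domain size, leads to a goal letter
(`isEmpty_iff`).

Extra letters never disable a step (`CanReachTarget.mono`). Hence the configurations that can reach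
the target are upward closed under sublists, and by Higman's lemma their minimal words have bounded
length (`exists_length_bound`). So unreachability has a finite witness: for some `L`, a set of words
of length at most `L` that contains the goals, is closed upwards and under predecessors within that
length, lets each of its words of length `L` lose a letter, and avoids the initial words of length
at most `L` (`Certificate.not_canReach`, `exists_certificate`).

Initialization formulas may have quantifiers, so the initial colour varies with the domain size. In
an empty database, however, truth depends only on the equality pattern of the free variables and on
the domain size up to a threshold (`holds_empty_iff_eval`). The initial colour is therefore constant
from `L` on once `L` exceeds the formula codes (`initColor_stable`), and finitely many lengths have
to be tested.

Both runs to the target and certificates can be enumerated and checked by primitive recursive tests,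
so Post's theorem gives decidability. The tests evaluate formulas by tables of satisfying
assignments, computed by course-of-values recursion on Gödel codes (`primrec_table_ofCode`). -/

namespace DynComplexity

/-! ### Transfer nets and their monotonicity. -/

/-- A transfer net: a configuration consists of a global state and of a word of coloured elements.
A step chooses an operation and an element; the element is recoloured by `self`, all the others
by `other`, and the global state changes by `glob`. -/
structure TransferNet (Γ C O : Type) where
  op : O → Prop
  glob : O → Γ → C → Γ
  self : O → Γ → C → C
  other : O → Γ → C → C → C
  goal : Γ → C → Prop

namespace TransferNet

variable {Γ C O : Type} (N : TransferNet Γ C O)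

/-- The successor configuration when the element `a` between `l₁` and `l₂` is chosen. -/
def next (o : O) (g : Γ) (l₁ : List C) (a : C) (l₂ : List C) : Γ × List C :=
  (N.glob o g a, l₁.map (N.other o g a) ++ N.self o g a :: l₂.map (N.other o g a))

def Step (s t : Γ × List C) : Prop :=
  ∃ o, N.op o ∧ ∃ l₁ a l₂, s.2 = l₁ ++ a :: l₂ ∧ t = N.next o s.1 l₁ a l₂

def Target (s : Γ × List C) : Prop := ∃ c ∈ s.2, N.goal s.1 c

/-- Some target configuration is reachable. -/
def CanReachTarget (s : Γ × List C) : Prop := ∃ t, Relation.ReflTransGen N.Step s t ∧ N.Target t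

/-- The larger word performs the same operation on a copy of the same letter. The remaining letters
are recoloured by one common function, which preserves sublists. -/
theorem Step.lift {N : TransferNet Γ C O} {g : Γ} {l m : List C} {t : Γ × List C}
    (hlm : l.Sublist m) (h : N.Step (g, l) t) :
    ∃ m', t.2.Sublist m' ∧ N.Step (g, m) (t.1, m') := by
  obtain ⟨o, ho, l₁, a, l₂, hl, rfl⟩ := h
  simp only at hl
  subst hl
  obtain ⟨m₁, m₂, rfl, h₁, h₂⟩ := List.append_sublist_iff.1 hlm
  obtain ⟨r₁, r₂, rfl, hr₁, hr₂⟩ := List.cons_sublist_iff.1 h₂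
  obtain ⟨q₁, q₂, rfl⟩ := List.append_of_mem hr₁
  refine ⟨_, ?_, o, ho, m₁ ++ q₁, a, q₂ ++ r₂, by simp, rfl⟩
  simp only [next]
  refine ((h₁.trans (List.sublist_append_left _ _)).map _).append (List.Sublist.cons_cons _ ?_)
  exact (hr₂.trans (List.sublist_append_right _ _)).map _

/-- A run is lifted step by step with `Step.lift`; the target condition survives because it asks
only for the presence of one letter. -/
theorem CanReachTarget.mono {g : Γ} {l m : List C} (hlm : l.Sublist m)
    (h : N.CanReachTarget (g, l)) : N.CanReachTarget (g, m) := by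
  obtain ⟨t, hst, ht⟩ := h
  generalize hs : (g, l) = s at hst
  induction hst using Relation.ReflTransGen.head_induction_on generalizing g l m with
  | refl =>
    subst hs
    obtain ⟨c, hc, hg⟩ := ht
    exact ⟨(g, m), .refl, c, hlm.subset hc, hg⟩
  | head h₁ _ ih =>
    subst hs
    obtain ⟨m', hm', hstep⟩ := h₁.lift hlm
    obtain ⟨u, hu, hu'⟩ := ih hm' rfl
    exact ⟨u, hu.head hstep, hu'⟩

theorem CanReachTarget.of_step {s t : Γ × List C} (h : N.Step s t)
    (ht : N.CanReachTarget t) : N.CanReachTarget s :=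
  let ⟨u, hu, hu'⟩ := ht
  ⟨u, hu.head h, hu'⟩

end TransferNet

/-! ### Higman's lemma and bounded minimal words. -/

theorem exists_sublist_erase {C : Type} {t l : List C} (h : t.Sublist l)
    (hlt : t.length < l.length) : ∃ l₁ a l₂, l = l₁ ++ a :: l₂ ∧ t.Sublist (l₁ ++ l₂) := by
  induction h with
  | slnil => simp at hlt
  | cons a h _ => exact ⟨[], a, _, rfl, h⟩
  | cons_cons a h ih =>
    obtain ⟨l₁, b, l₂, rfl, h'⟩ := ih (by simpa using hlt)
    exact ⟨a :: l₁, b, l₂, rfl, h'.cons_cons a⟩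

/-- By Higman's lemma, an upward closed set of configurations over finitely many global states
and colours has minimal elements of bounded length only. -/
theorem exists_length_bound {Γ C : Type} {A : Set C} {B : Set Γ} (hA : A.Finite) (hB : B.Finite)
    (U : Γ × List C → Prop) :
    ∃ M, ∀ g ∈ B, ∀ l : List C, (∀ c ∈ l, c ∈ A) → U (g, l) →
      ∃ t, t.Sublist l ∧ t.length ≤ M ∧ U (g, t) := by
  have key : ∀ g ∈ B, ∃ M, ∀ l : List C, (∀ c ∈ l, c ∈ A) → U (g, l) →
      ∃ t, t.Sublist l ∧ t.length ≤ M ∧ U (g, t) := by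
    intro g _
    by_contra! hcon
    choose f hfA hfU hf using hcon
    have hw : A.PartiallyWellOrderedOn (@Eq C) := hA.partiallyWellOrderedOn
    have hH := hw.partiallyWellOrderedOn_sublistForall₂ (@Eq C)
    have : IsPreorder (List C) (List.SublistForall₂ (@Eq C)) := { }
    obtain ⟨φ, hφ⟩ := hH.exists_monotone_subseq (f := f) hfA
    -- `f M` is a word with no good sublist of length at most `M`. Taking the index `m = (f (φ
    -- 0)).length` makes `f (φ 0)` a good sublist of `f (φ m)` of length `m ≤ φ m`, a contradiction.
    have hs := hφ 0 (f (φ 0)).length (Nat.zero_le _)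
    rw [List.sublistForall₂_iff] at hs
    obtain ⟨l, hl, hl'⟩ := hs
    rw [List.forall₂_eq_eq_eq] at hl
    subst hl
    exact hf _ _ hl' (φ.strictMono.le_apply) (hfU _)
  choose! M hM using key
  obtain ⟨K, hK⟩ := (hB.image M).bddAbove
  refine ⟨K, fun g hg l hl hu => ?_⟩
  obtain ⟨t, h1, h2, h3⟩ := hM g hg l hl hu
  exact ⟨t, h1, h2.trans (hK ⟨g, hg, rfl⟩), h3⟩

/-! ### Finite certificates of unreachability. -/

namespace TransferNet

variable {Γ C O : Type} (N : TransferNet Γ C O)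

/-- `A` and `B` are closed under the operations of the net. -/
structure Invariant (A : Set C) (B : Set Γ) : Prop where
  glob : ∀ o, ∀ g ∈ B, ∀ a ∈ A, N.glob o g a ∈ B
  self : ∀ o, ∀ g ∈ B, ∀ a ∈ A, N.self o g a ∈ A
  other : ∀ o, ∀ g ∈ B, ∀ a ∈ A, ∀ b ∈ A, N.other o g a b ∈ A

/-- A certificate that no configuration `(g₀ n, c₀ n ⋯ c₀ n)` of length `n ≥ 1` leads to a
target. -/
structure Certificate (A : Set C) (B : Set Γ) (g₀ : ℕ → Γ) (c₀ : ℕ → C) (L : ℕ)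
    (W : Γ × List C → Prop) : Prop where
  pos : 0 < L
  goal : ∀ g ∈ B, ∀ c ∈ A, N.goal g c → W (g, [c])
  up : ∀ g ∈ B, ∀ a ∈ A, ∀ l₁ l₂ : List C, (∀ c ∈ l₁, c ∈ A) → (∀ c ∈ l₂, c ∈ A) →
    l₁.length + l₂.length < L → W (g, l₁ ++ l₂) → W (g, l₁ ++ a :: l₂)
  step : ∀ g ∈ B, ∀ a ∈ A, ∀ l₁ l₂ : List C, (∀ c ∈ l₁, c ∈ A) → (∀ c ∈ l₂, c ∈ A) →
    l₁.length + l₂.length < L → ∀ o, N.op o → W (N.next o g l₁ a l₂) → W (g, l₁ ++ a :: l₂)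
  shrink : ∀ g ∈ B, ∀ l : List C, (∀ c ∈ l, c ∈ A) → l.length = L → W (g, l) →
    ∃ l₁ a l₂, l = l₁ ++ a :: l₂ ∧ W (g, l₁ ++ l₂)
  init : ∀ n, 0 < n → n ≤ L → ¬ W (g₀ n, List.replicate n (c₀ n))

variable {N} {A : Set C} {B : Set Γ} {g₀ : ℕ → Γ} {c₀ : ℕ → C} {L : ℕ}
  {W : Γ × List C → Prop}

/-- The field `up` inserts one letter at a time; iterating it climbs from `t` to `l` without
exceeding length `L`. -/
theorem Certificate.mono (h : N.Certificate A B g₀ c₀ L W) {g : Γ} (hg : g ∈ B) {t : List C}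
    (ht : W (g, t)) (l : List C) (hl : ∀ c ∈ l, c ∈ A) (hlL : l.length ≤ L)
    (htl : t.Sublist l) : W (g, l) := by
  induction hn : l.length generalizing l with
  | zero =>
    obtain rfl := List.length_eq_zero_iff.1 hn
    rwa [List.sublist_nil.1 htl] at ht
  | succ n ih =>
    rcases htl.length_le.lt_or_eq with hlt | heq
    · obtain ⟨l₁, a, l₂, rfl, h'⟩ := exists_sublist_erase htl hlt
      simp only [List.length_append, List.length_cons] at hn hlL
      simp only [List.mem_append, List.mem_cons] at hl
      refine h.up g hg a (hl _ (by simp)) l₁ l₂ (fun c hc => hl _ (by simp [hc]))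
        (fun c hc => hl _ (by simp [hc])) (by omega)
        (ih _ (fun c hc => ?_) (by simp; omega) h' (by simp; omega))
      rcases List.mem_append.1 hc with hc | hc <;> exact hl _ (by simp [hc])
    · rwa [htl.eq_of_length heq] at ht

/-- Backward invariance of the upward closure of `W`, for words of any length: only the witnessing
sublist is pulled back along the step, and it stays short. -/
theorem Certificate.exists_sublist_of_step (h : N.Certificate A B g₀ c₀ L W)
    (hN : N.Invariant A B) {s s' : Γ × List C} (hg : s.1 ∈ B) (hl : ∀ c ∈ s.2, c ∈ A)
    (hs : N.Step s s') (hs' : ∃ t, t.Sublist s'.2 ∧ t.length ≤ L ∧ W (s'.1, t)) :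
    ∃ t, t.Sublist s.2 ∧ t.length ≤ L ∧ W (s.1, t) := by
  obtain ⟨g, l⟩ := s
  obtain ⟨o, ho, m₁, a, m₂, rfl, rfl⟩ := hs
  simp only [List.mem_append, List.mem_cons] at hg hl ⊢
  have ha : a ∈ A := hl _ (by simp)
  have hm₁ : ∀ c ∈ m₁, c ∈ A := fun c hc => hl _ (by simp [hc])
  have hm₂ : ∀ c ∈ m₂, c ∈ A := fun c hc => hl _ (by simp [hc])
  have hmap : ∀ m : List C, (∀ c ∈ m, c ∈ A) → ∀ c ∈ m.map (N.other o g a), c ∈ A := by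
    intro m hm c hc
    obtain ⟨b, hb, rfl⟩ := List.mem_map.1 hc
    exact hN.other o g hg a ha b (hm b hb)
  have hval : ∀ u₁ u₂ : List C, (∀ c ∈ u₁, c ∈ A) → (∀ c ∈ u₂, c ∈ A) →
      ∀ c ∈ u₁ ++ u₂, c ∈ A := by
    intro u₁ u₂ h₁ h₂ c hc
    rcases List.mem_append.1 hc with hc | hc
    exacts [h₁ c hc, h₂ c hc]
  have hval' : ∀ u₁ u₂ : List C, (∀ c ∈ u₁, c ∈ A) → (∀ c ∈ u₂, c ∈ A) →
      ∀ c ∈ u₁ ++ N.self o g a :: u₂, c ∈ A := by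
    intro u₁ u₂ h₁ h₂
    refine hval _ _ h₁ fun c hc => ?_
    rcases List.mem_cons.1 hc with rfl | hc
    exacts [hN.self o g hg a ha, h₂ c hc]
  -- Pulling back may add the chosen letter, so a witness of length exactly `L` is shortened first.
  have hsmall : ∃ t, t.Sublist (N.next o g m₁ a m₂).2 ∧ t.length < L ∧
      W ((N.next o g m₁ a m₂).1, t) := by
    obtain ⟨t, ht, htL, hW⟩ := hs'
    rcases htL.lt_or_eq with hlt | heq
    · exact ⟨t, ht, hlt, hW⟩
    · have htA : ∀ c ∈ t, c ∈ A := fun c hc =>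
        hval' _ _ (hmap _ hm₁) (hmap _ hm₂) c (ht.subset hc)
      obtain ⟨l₁, b, l₂, rfl, hW'⟩ := h.shrink _ (hN.glob o g hg a ha) t htA heq hW
      refine ⟨l₁ ++ l₂, ((List.Sublist.refl l₁).append (List.sublist_cons_self b l₂)).trans ht,
        ?_, hW'⟩
      simp only [List.length_append, List.length_cons] at heq ⊢
      omega
  obtain ⟨t, ht, htL, hW⟩ := hsmall
  obtain ⟨t₁, t₂, rfl, h₁, h₂⟩ := List.sublist_append_iff.1 ht
  obtain ⟨u₁, hu₁, rfl⟩ := List.sublist_map_iff.1 h₁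
  have hu₁A : ∀ c ∈ u₁, c ∈ A := fun c hc => hm₁ c (hu₁.subset hc)
  -- If the witness omits the recoloured chosen letter, `up` inserts it before `step` is applied;
  -- otherwise `step` applies at once.
  rcases List.sublist_cons_iff.1 h₂ with h₃ | ⟨r, rfl, h₃⟩
  · obtain ⟨u₂, hu₂, rfl⟩ := List.sublist_map_iff.1 h₃
    have hu₂A : ∀ c ∈ u₂, c ∈ A := fun c hc => hm₂ c (hu₂.subset hc)
    simp only [List.length_append, List.length_map] at htL
    refine ⟨u₁ ++ a :: u₂, hu₁.append (hu₂.cons_cons a), by simp; omega, ?_⟩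
    refine h.step g hg a ha u₁ u₂ hu₁A hu₂A htL o ho ?_
    exact h.up _ (hN.glob o g hg a ha) _ (hN.self o g hg a ha) _ _ (hmap _ hu₁A) (hmap _ hu₂A)
      (by simpa using htL) hW
  · obtain ⟨u₂, hu₂, rfl⟩ := List.sublist_map_iff.1 h₃
    have hu₂A : ∀ c ∈ u₂, c ∈ A := fun c hc => hm₂ c (hu₂.subset hc)
    simp only [List.length_append, List.length_map, List.length_cons] at htL
    refine ⟨u₁ ++ a :: u₂, hu₁.append (hu₂.cons_cons a), by simp; omega, ?_⟩
    exact h.step g hg a ha u₁ u₂ hu₁A hu₂A (by omega) o ho hW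

theorem Certificate.exists_sublist_of_canReach (h : N.Certificate A B g₀ c₀ L W)
    (hN : N.Invariant A B) {s : Γ × List C} (hg : s.1 ∈ B) (hl : ∀ c ∈ s.2, c ∈ A)
    (hs : N.CanReachTarget s) : ∃ t, t.Sublist s.2 ∧ t.length ≤ L ∧ W (s.1, t) := by
  obtain ⟨t, hst, ht⟩ := hs
  induction hst using Relation.ReflTransGen.head_induction_on with
  | refl =>
    obtain ⟨c, hc, hgoal⟩ := ht
    exact ⟨[c], by simpa using hc, h.pos, h.goal _ hg c (hl c hc) hgoal⟩
  | head h₁ _ ih =>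
    refine h.exists_sublist_of_step hN hg hl h₁ (ih ?_ ?_)
    · obtain ⟨o, -, l₁, a, l₂, heq, rfl⟩ := h₁
      exact hN.glob o _ hg a (hl a (by simp [heq]))
    · obtain ⟨o, -, l₁, a, l₂, heq, rfl⟩ := h₁
      have ha := hl a (by simp [heq])
      intro c hc
      simp only [next, List.mem_append, List.mem_map, List.mem_cons] at hc
      rcases hc with ⟨b, hb, rfl⟩ | rfl | ⟨b, hb, rfl⟩
      · exact hN.other o _ hg a ha b (hl b (by simp [heq, hb]))
      · exact hN.self o _ hg a ha
      · exact hN.other o _ hg a ha b (hl b (by simp [heq, hb]))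

/-- A reachable target would put a sublist of the initial word into `W`. If `n ≤ L`, `W` then
contains the initial word itself. If `n ≥ L`, the sublist is a power of the stable letter `c₀ L`, so
`W` contains the initial word of length `L`. Both contradict `init`. -/
theorem Certificate.not_canReach (h : N.Certificate A B g₀ c₀ L W) (hN : N.Invariant A B)
    (hg₀ : ∀ n, g₀ n ∈ B) (hc₀ : ∀ n, c₀ n ∈ A) (hstable : ∀ n, L ≤ n → g₀ n = g₀ L ∧ c₀ n = c₀ L)
    {n : ℕ} (hn : 0 < n) : ¬ N.CanReachTarget (g₀ n, List.replicate n (c₀ n)) := by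
  intro hu
  obtain ⟨t, ht, htL, hW⟩ := h.exists_sublist_of_canReach hN (hg₀ n)
    (fun c (hc : c ∈ List.replicate n (c₀ n)) => (List.eq_of_mem_replicate hc) ▸ hc₀ n) hu
  simp only at ht hW
  rcases le_total n L with hnL | hLn
  · exact h.init n hn hnL (h.mono (hg₀ n) hW _
      (fun c hc => (List.eq_of_mem_replicate hc) ▸ hc₀ n) (by simpa using hnL) ht)
  · obtain ⟨e₁, e₂⟩ := hstable n hLn
    rw [e₁] at hW
    refine h.init L h.pos le_rfl (h.mono (hg₀ L) hW _
      (fun c hc => (List.eq_of_mem_replicate hc) ▸ hc₀ L) (by simp) ?_)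
    rw [e₂] at ht
    obtain ⟨k, -, rfl⟩ := List.sublist_replicate_iff.1 ht
    exact List.replicate_sublist_replicate _ |>.2 (by simpa using htL)

/-- The set of configurations that can reach the target is itself a certificate as soon as `L`
exceeds the Higman bound `M`: a word of length `L` then has a proper sublist in the set, and some
letter outside it can be dropped. -/
theorem exists_certificate (hA : A.Finite) (hB : B.Finite) (K : ℕ)
    (h : ∀ n, 0 < n → ¬ N.CanReachTarget (g₀ n, List.replicate n (c₀ n))) :
    ∃ L, K ≤ L ∧ N.Certificate A B g₀ c₀ L N.CanReachTarget := by
  obtain ⟨M, hM⟩ := exists_length_bound hA hB N.CanReachTarget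
  refine ⟨max K (M + 1), le_max_left _ _, ?_⟩
  constructor
  · exact lt_of_lt_of_le (Nat.succ_pos M) (le_max_right _ _)
  · exact fun g _ c _ hgoal => ⟨_, .refl, c, by simp, hgoal⟩
  · exact fun g _ a _ l₁ l₂ _ _ _ hu =>
      hu.mono N ((List.Sublist.refl l₁).append (List.sublist_cons_self a l₂))
  · exact fun g _ a _ l₁ l₂ _ _ _ o ho hu => hu.of_step N ⟨o, ho, l₁, a, l₂, rfl, rfl⟩
  · intro g hg l hl hlen hu
    obtain ⟨t, ht, htM, hut⟩ := hM g hg l hl hu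
    have : M + 1 ≤ l.length := hlen ▸ le_max_right _ _
    obtain ⟨l₁, a, l₂, rfl, ht'⟩ := exists_sublist_erase ht (by omega)
    exact ⟨l₁, a, l₂, rfl, hut.mono N ht'⟩
  · exact fun n hn _ => h n hn

end TransferNet

/-! ### Configurations and evaluation of formulas by finite tables. -/

/-- The words of length `n` over the alphabet `A`. -/
def words {α : Type} (A : List α) : ℕ → List (List α)
  | 0 => [[]]
  | n + 1 => A.flatMap fun a => (words A n).map (a :: ·)

theorem mem_words {α : Type} {A : List α} {n : ℕ} {l : List α} :
    l ∈ words A n ↔ l.length = n ∧ ∀ x ∈ l, x ∈ A := by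
  induction n generalizing l with
  | zero => simp +contextual [words, List.length_eq_zero_iff]
  | succ n ih =>
    simp only [words, List.mem_flatMap, List.mem_map, ih]
    constructor
    · rintro ⟨a, ha, l, ⟨hl, hl'⟩, rfl⟩
      simpa [hl, ha] using hl'
    · rintro ⟨h, h'⟩
      obtain ⟨a, l, rfl⟩ := List.exists_cons_of_length_eq_add_one h
      simp only [List.mem_cons, forall_eq_or_imp] at h'
      exact ⟨a, h'.1, l, ⟨by simpa using h, h'.2⟩, rfl⟩

theorem getD_map_range {α : Type} (f : ℕ → α) (n i : ℕ) (d : α) :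
    ((List.range n).map f).getD i d = if i < n then f i else d := by
  rw [List.getD_eq_getElem?_getD]
  split_ifs with h
  · simp [h]
  · simp [not_lt.1 h]

/-- A colour: the truth values of the input and of the auxiliary symbols. -/
abbrev Color : Type := List Bool × List Bool

/-- The truth values of the nullary symbols, and the colour of every element. -/
abbrev Config : Type := Color × List Color

/-- The truth value of an atom with at most one argument, where `g` holds the values of the nullary
symbols and `l` those of the unary symbols at every element. -/
def atomValue (g : List Bool) (l : List (List Bool)) (i : ℕ) (args : List ℕ) : Bool :=
  (if args = [] then g else l.getD args.headI []).getD i false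

namespace Fml

/-- Truth of a formula in a configuration, whose elements are the positions of its word. -/
def Eval (s : Config) : (ℕ → ℕ) → Fml → Prop
  | _, falsum => False
  | v, equal x y => v x = v y
  | v, inp i args => atomValue s.1.1 (s.2.map Prod.fst) i (args.map v) = true
  | v, aux i args => atomValue s.1.2 (s.2.map Prod.snd) i (args.map v) = true
  | v, imp φ ψ => Eval s v φ → Eval s v ψ
  | v, all x φ => ∀ d < s.2.length, Eval s (Function.update v x d) φ

/-- The assignments to the variables below `K` that satisfy a formula in a configuration. -/
def table (s : Config) (K : ℕ) : Fml → List (List ℕ)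
  | falsum => []
  | equal x y => (words (List.range s.2.length) K).filter fun v => v.getD x 0 == v.getD y 0
  | inp i args => (words (List.range s.2.length) K).filter fun v =>
      atomValue s.1.1 (s.2.map Prod.fst) i (args.map fun x => v.getD x 0)
  | aux i args => (words (List.range s.2.length) K).filter fun v =>
      atomValue s.1.2 (s.2.map Prod.snd) i (args.map fun x => v.getD x 0)
  | imp φ ψ => (words (List.range s.2.length) K).filter fun v =>
      !(table s K φ).contains v || (table s K ψ).contains v
  | all x φ => (words (List.range s.2.length) K).filter fun v =>
      (List.range s.2.length).all fun d => (table s K φ).contains (v.set x d)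

theorem lt_encode_of_mem {x : ℕ} {l : List ℕ} (h : x ∈ l) : x < Encodable.encode l := by
  induction l with
  | nil => simp at h
  | cons a l ih =>
    rw [Encodable.encode_list_cons, Nat.lt_succ_iff]
    rcases List.mem_cons.1 h with rfl | h
    · exact Nat.left_le_pair _ _
    · exact (ih h).le.trans (Nat.right_le_pair _ _)

/-- The code of a formula bounds every variable in it, bound ones included, so assignments of length
`K` cover all variables and `List.set` at a quantified variable is never out of range. -/
theorem mem_table {s : Config} {K : ℕ} {φ : Fml} (hφ : φ.code < K) {v : List ℕ}
    (hv : v ∈ words (List.range s.2.length) K) {w : ℕ → ℕ} (hw : ∀ j < K, v.getD j 0 = w j) :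
    v ∈ φ.table s K ↔ φ.Eval s w := by
  have hargs : ∀ args : List ℕ, Encodable.encode args ≤ K →
      (args.map fun x => v.getD x 0) = args.map w := fun args h =>
    List.map_congr_left fun x hx => hw x ((lt_encode_of_mem hx).trans_le h)
  induction φ generalizing v w with
  | falsum => simp [table, Eval]
  | equal x y =>
    simp only [code] at hφ
    have h1 := Nat.left_le_pair x y
    have h2 := Nat.right_le_pair x y
    simp only [table, Eval, List.mem_filter, hv, true_and, beq_iff_eq, hw x (by omega),
      hw y (by omega)]
  | inp i args =>
    simp only [code] at hφ
    have h2 := Nat.right_le_pair i (Encodable.encode args)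
    simp only [table, Eval, List.mem_filter, hv, true_and, hargs args (by omega)]
  | aux i args =>
    simp only [code] at hφ
    have h2 := Nat.right_le_pair i (Encodable.encode args)
    simp only [table, Eval, List.mem_filter, hv, true_and, hargs args (by omega)]
  | imp φ ψ ih₁ ih₂ =>
    simp only [code] at hφ
    have h1 := Nat.left_le_pair φ.code ψ.code
    have h2 := Nat.right_le_pair φ.code ψ.code
    simp only [table, Eval, List.mem_filter, hv, true_and, Bool.or_eq_true, Bool.not_eq_true',
      List.contains_eq_mem, decide_eq_false_iff_not, decide_eq_true_eq,
      ih₁ (by omega) hv hw hargs, ih₂ (by omega) hv hw hargs]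
    tauto
  | all x φ ih =>
    simp only [code] at hφ
    have h1 := Nat.left_le_pair x φ.code
    have h2 := Nat.right_le_pair x φ.code
    obtain ⟨hlen, hmem⟩ := mem_words.1 hv
    simp only [table, Eval, List.mem_filter, hv, true_and, List.all_eq_true, List.mem_range,
      List.contains_eq_mem, decide_eq_true_eq]
    refine forall₂_congr fun d hd => ?_
    have hw' : ∀ j < K, (v.set x d).getD j 0 = Function.update w x d j := by
      intro j hj
      rw [Function.update_apply, List.getD_eq_getElem?_getD, List.getElem?_set]
      split_ifs with e1 e2 e3 e4
      · simp
      · omega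
      · omega
      · omega
      · omega
      · rw [← List.getD_eq_getElem?_getD, hw j hj]
    refine ih (by omega) (mem_words.2 ⟨by simpa using hlen, fun y hy => ?_⟩) hw' fun args h =>
      List.map_congr_left fun x hx => hw' x ((lt_encode_of_mem hx).trans_le h)
    rcases List.mem_or_eq_of_mem_set hy with hy | rfl
    · exact hmem y hy
    · simpa using hd

/-- The truth value of a formula in a configuration, where variable `0` is mapped to `w₀` and all
other variables to `w₁`. -/
noncomputable def value (s : Config) (φ : Fml) (w₀ w₁ : ℕ) : Bool :=
  (φ.table s (Encodable.encode φ + 1)).contains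
    ((List.range (Encodable.encode φ + 1)).map fun j => if j = 0 then w₀ else w₁)

theorem encode_eq_code (φ : Fml) : Encodable.encode φ = φ.code := rfl

theorem value_eq_true_iff {s : Config} {φ : Fml} {w₀ w₁ : ℕ} (h₀ : w₀ < s.2.length)
    (h₁ : w₁ < s.2.length) :
    φ.value s w₀ w₁ = true ↔ φ.Eval s fun j => if j = 0 then w₀ else w₁ := by
  rw [value, List.contains_eq_mem, decide_eq_true_eq]
  refine mem_table (by rw [encode_eq_code]; omega) (mem_words.2 ⟨by simp, fun x hx => ?_⟩)
    fun j hj => by rw [getD_map_range, if_pos hj]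
  obtain ⟨j, -, rfl⟩ := List.mem_map.1 hx
  split_ifs <;> simpa

theorem le_code_of_mem_freeVars {φ : Fml} {x : ℕ} (h : x ∈ φ.freeVars) : x ≤ φ.code := by
  induction φ with
  | falsum => simp [freeVars] at h
  | equal y z =>
    have h1 := Nat.left_le_pair y z
    have h2 := Nat.right_le_pair y z
    simp only [freeVars, Finset.mem_insert, Finset.mem_singleton] at h
    simp only [code]
    omega
  | inp i args =>
    have h2 := Nat.right_le_pair i (Encodable.encode args)
    have := lt_encode_of_mem (List.mem_toFinset.1 h)
    simp only [code]
    omega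
  | aux i args =>
    have h2 := Nat.right_le_pair i (Encodable.encode args)
    have := lt_encode_of_mem (List.mem_toFinset.1 h)
    simp only [code]
    omega
  | imp φ ψ ih₁ ih₂ =>
    have h1 := Nat.left_le_pair φ.code ψ.code
    have h2 := Nat.right_le_pair φ.code ψ.code
    simp only [code]
    rcases Finset.mem_union.1 h with h | h
    · have := ih₁ h; omega
    · have := ih₂ h; omega
  | all y φ ih =>
    have h2 := Nat.right_le_pair y φ.code
    have := ih (Finset.mem_of_mem_erase h)
    simp only [code]
    omega

/-! ### Truth in empty databases. -/

/-- The configuration with `n` elements in which no atom holds. -/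
def emptyConfig (n : ℕ) : Config := (([], []), List.replicate n ([], []))

/-- The set of pairs `(v x, w x)` projects injectively to both sides. Consequently two assignments
with the same equality pattern leave the same number of values used, which decides whether a fresh
value exists. -/
theorem card_image_eq_of_pattern {α β γ : Type} [DecidableEq β] [DecidableEq γ] {s : Finset α}
    {v : α → β} {w : α → γ} (h : ∀ x ∈ s, ∀ y ∈ s, v x = v y ↔ w x = w y) :
    (s.image v).card = (s.image w).card := by
  have h1 : ((s.image fun x => (v x, w x)).image Prod.fst).card =
      (s.image fun x => (v x, w x)).card := by
    refine Finset.card_image_of_injOn fun p hp q hq hpq => ?_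
    simp only [Finset.coe_image, Set.mem_image, Finset.mem_coe] at hp hq
    obtain ⟨x, hx, rfl⟩ := hp
    obtain ⟨y, hy, rfl⟩ := hq
    exact Prod.ext hpq ((h x hx y hy).1 hpq)
  have h2 : ((s.image fun x => (v x, w x)).image Prod.snd).card =
      (s.image fun x => (v x, w x)).card := by
    refine Finset.card_image_of_injOn fun p hp q hq hpq => ?_
    simp only [Finset.coe_image, Set.mem_image, Finset.mem_coe] at hp hq
    obtain ⟨x, hx, rfl⟩ := hp
    obtain ⟨y, hy, rfl⟩ := hq
    exact Prod.ext ((h x hx y hy).2 hpq) hpq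
  rw [Finset.image_image] at h1 h2
  exact h1.trans h2.symm

/-- One round of an Ehrenfeucht–Fraïssé game for pure equality. -/
theorem update_pattern {α β γ : Type} [DecidableEq α] {s : Finset α} {x : α}
    {v : α → β} {w : α → γ} (h : ∀ y ∈ s.erase x, ∀ z ∈ s.erase x, v y = v z ↔ w y = w z)
    {b : β} {c : γ} (hbc : ∀ y ∈ s.erase x, v y = b ↔ w y = c) :
    ∀ y ∈ s, ∀ z ∈ s, Function.update v x b y = Function.update v x b z ↔
      Function.update w x c y = Function.update w x c z := by
  intro y hy z hz
  rcases eq_or_ne y x with rfl | hyx <;> rcases eq_or_ne z y with rfl | hzx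
  · simp
  · have := hbc z (Finset.mem_erase.2 ⟨hzx, hz⟩)
    simp only [Function.update_self, Function.update_of_ne hzx]
    rw [eq_comm, this, eq_comm]
  · simp
  · rcases eq_or_ne z x with rfl | hz'
    · simpa [Function.update_of_ne hyx] using hbc y (Finset.mem_erase.2 ⟨hyx, hy⟩)
    · simpa [Function.update_of_ne hyx, Function.update_of_ne hz'] using
        h y (Finset.mem_erase.2 ⟨hyx, hy⟩) z (Finset.mem_erase.2 ⟨hz', hz⟩)

theorem atomValue_empty (n i : ℕ) (args : List ℕ) (f : Color → List Bool)
    (hf : f ([], []) = []) : atomValue [] ((List.replicate n ([], [])).map f) i args = false := by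
  simp [atomValue, hf]

/-- In structures without any tuple, the truth of a formula depends only on which variables have
equal values and on the size of the domain up to a threshold. -/
theorem holds_empty_iff_eval {D : Type} [Finite D] {n K : ℕ}
    (hcard : min (Nat.card D) K = min n K) {φ : Fml} (hφ : φ.code < K) {v : ℕ → D} {w : ℕ → ℕ}
    (hw : ∀ x ∈ φ.freeVars, w x < n)
    (hvw : ∀ x ∈ φ.freeVars, ∀ y ∈ φ.freeVars, v x = v y ↔ w x = w y) :
    φ.Holds ⟨fun _ => ∅, fun _ => ∅⟩ v ↔ φ.Eval (emptyConfig n) w := by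
  classical
  induction φ generalizing v w with
  | falsum => rfl
  | equal x y => exact hvw x (by simp [freeVars]) y (by simp [freeVars])
  | inp i args =>
    simp [Holds, Eval, emptyConfig, -List.map_replicate, atomValue_empty n i _ Prod.fst rfl]
  | aux i args =>
    simp [Holds, Eval, emptyConfig, -List.map_replicate, atomValue_empty n i _ Prod.snd rfl]
  | imp φ ψ ih₁ ih₂ =>
    simp only [code] at hφ
    have h1 := Nat.left_le_pair φ.code ψ.code
    have h2 := Nat.right_le_pair φ.code ψ.code
    simp only [freeVars, Finset.mem_union] at hw hvw
    simp only [Holds, Eval]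
    rw [ih₁ (by omega) (fun x hx => hw x (.inl hx))
        fun x hx y hy => hvw x (.inl hx) y (.inl hy),
      ih₂ (by omega) (fun x hx => hw x (.inr hx)) fun x hx y hy => hvw x (.inr hx) y (.inr hy)]
  | all x φ ih =>
    have hfv : insert x (φ.freeVars.erase x) ⊆ Finset.range K := by
      intro y hy
      simp only [code] at hφ
      have h1 := Nat.left_le_pair x φ.code
      have h2 := Nat.right_le_pair x φ.code
      rcases Finset.mem_insert.1 hy with rfl | hy
      · exact Finset.mem_range.2 (by omega)
      · have := le_code_of_mem_freeVars (Finset.mem_of_mem_erase hy)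
        exact Finset.mem_range.2 (by omega)
    have hsmall : (φ.freeVars.erase x).card < K := by
      have := Finset.card_le_card hfv
      rw [Finset.card_insert_of_notMem (Finset.notMem_erase _ _), Finset.card_range] at this
      omega
    have himg := card_image_eq_of_pattern hvw
    simp only [freeVars] at himg hw hvw
    have hcv := (Finset.card_image_le (s := φ.freeVars.erase x) (f := v)).trans_lt hsmall
    have hsub : (φ.freeVars.erase x).image w ⊆ Finset.range n := by
      intro d hd
      obtain ⟨y, hy, rfl⟩ := Finset.mem_image.1 hd
      exact Finset.mem_range.2 (hw y hy)
    have hφ' : φ.code < K := by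
      simp only [code] at hφ
      have h2 := Nat.right_le_pair x φ.code
      omega
    have step : ∀ (b : D) (c : ℕ), c < n → (∀ y ∈ φ.freeVars.erase x, v y = b ↔ w y = c) →
        (φ.Holds ⟨fun _ => ∅, fun _ => ∅⟩ (Function.update v x b) ↔
          φ.Eval (emptyConfig n) (Function.update w x c)) := by
      intro b c hc hbc
      refine ih hφ' (fun y hy => ?_) (update_pattern hvw hbc)
      rcases eq_or_ne y x with rfl | hyx
      · simpa using hc
      · simpa [Function.update_of_ne hyx] using hw y (Finset.mem_erase.2 ⟨hyx, hy⟩)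
    simp only [Holds, Eval]
    have hlen : (emptyConfig n).2.length = n := by simp [emptyConfig]
    rw [hlen]
    constructor
    · intro h c hc
      -- A value already used is answered by the value of the same variable. A fresh one is answered
      -- by a fresh one, which exists because equally many values, fewer than `K`, are used on both
      -- sides.
      by_cases hmem : c ∈ (φ.freeVars.erase x).image w
      · obtain ⟨y, hy, rfl⟩ := Finset.mem_image.1 hmem
        exact (step (v y) _ hc fun z hz => hvw z hz y hy).1 (h _)
      · have h1 : ((φ.freeVars.erase x).image w).card < n := by
          have := Finset.card_lt_card (Finset.ssubset_iff_of_subset hsub |>.2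
            ⟨c, Finset.mem_range.2 hc, hmem⟩)
          simpa using this
        obtain ⟨b, hb⟩ : ∃ b, b ∉ (φ.freeVars.erase x).image v := by
          by_contra! hall
          have := Fintype.ofFinite D
          have h3 : (Finset.univ : Finset D) ⊆ (φ.freeVars.erase x).image v := fun b _ => hall b
          have h4 := Finset.card_le_card h3
          rw [Finset.card_univ, ← Nat.card_eq_fintype_card] at h4
          omega
        refine (step b c hc fun z hz => ⟨fun e => ?_, fun e => ?_⟩).1 (h b)
        · exact absurd (Finset.mem_image.2 ⟨z, hz, e⟩) hb
        · exact absurd (Finset.mem_image.2 ⟨z, hz, e⟩) hmem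
    · intro h b
      by_cases hmem : b ∈ (φ.freeVars.erase x).image v
      · obtain ⟨y, hy, rfl⟩ := Finset.mem_image.1 hmem
        exact (step _ (w y) (hw y hy) fun z hz => hvw z hz y hy).2 (h _ (hw y hy))
      · have h1 : ((φ.freeVars.erase x).image v).card < Nat.card D := by
          have := Fintype.ofFinite D
          rw [Nat.card_eq_fintype_card, ← Finset.card_univ]
          exact Finset.card_lt_card (Finset.ssubset_iff_of_subset (Finset.subset_univ _) |>.2
            ⟨b, Finset.mem_univ _, hmem⟩)
        obtain ⟨c, hc, hc'⟩ : ∃ c ∈ Finset.range n, c ∉ (φ.freeVars.erase x).image w := by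
          by_contra! hall
          have h4 := Finset.card_le_card hall
          rw [Finset.card_range] at h4
          omega
        rw [Finset.mem_range] at hc
        refine (step b c hc fun z hz => ⟨fun e => ?_, fun e => ?_⟩).2 (h c hc)
        · exact absurd (Finset.mem_image.2 ⟨z, hz, e⟩) hmem
        · exact absurd (Finset.mem_image.2 ⟨z, hz, e⟩) hc'

end Fml

/-! ### The transfer net of a program. -/

namespace DynProgram

/-- The update formula of `R` for the operation `o = (b, S)`: an insertion into `S` if `b` holds,
and a deletion otherwise. -/
def opFml (P : DynProgram) (o : Bool × ℕ) (R : ℕ) : Fml :=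
  ((if o.1 then P.insFml else P.delFml).getD o.2 []).getD R .falsum

/-- The new values of the auxiliary symbols: the update formulas evaluated in `s`. -/
noncomputable def newAux (P : DynProgram) (o : Bool × ℕ) (s : Config) (w₀ w₁ : ℕ) : List Bool :=
  (List.range P.auxAr.length).map fun R => (P.opFml o R).value s w₀ w₁

/-- This serves both the global colour and the chosen letter. Each carries entries for symbols of
every arity; entries of the wrong arity are never read. -/
def newInp (P : DynProgram) (o : Bool × ℕ) (c : List Bool) : List Bool :=
  (List.range P.inAr.length).map fun S => if S = o.2 then o.1 else c.getD S false

/-- The transfer net that simulates a program with relations of arity at most one. -/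
noncomputable def net (P : DynProgram) : TransferNet Color Color (Bool × ℕ) where
  op o := o.2 < P.inAr.length
  glob o g a := (P.newInp o g.1, P.newAux o (g, [a, a]) 0 0)
  self o g a := (P.newInp o a.1, P.newAux o (g, [a, a]) 0 0)
  -- Position `0` is the modified element and position `1` the updated one. For a nullary operation
  -- the modified tuple is empty, so variable `0` already denotes the updated element.
  other o g a b := (b.1, P.newAux o (g, [a, b]) (if P.inAr.getD o.2 0 = 0 then 1 else 0) 1)
  goal g c := (if P.auxAr.getD P.query 0 = 0 then g else c).2.getD P.query false = true

/-- The global state, and also the colour of every element, of the initial state with domain size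
`n`. -/
noncomputable def initColor (P : DynProgram) (n : ℕ) : Color :=
  (List.replicate P.inAr.length false,
    (List.range P.auxAr.length).map fun R => (P.initFormula R).value (Fml.emptyConfig n) 0 0)

/-- The colours that can occur. -/
def colors (P : DynProgram) : List Color :=
  (words [true, false] P.inAr.length).flatMap fun a =>
    (words [true, false] P.auxAr.length).map fun b => (a, b)

theorem mem_colors {P : DynProgram} {c : Color} :
    c ∈ P.colors ↔ c.1.length = P.inAr.length ∧ c.2.length = P.auxAr.length := by
  obtain ⟨a, b⟩ := c
  have h : ∀ x : Bool, x = true ∨ x = false := by decide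
  simp [colors, mem_words, h]

theorem net_invariant (P : DynProgram) :
    P.net.Invariant {c | c ∈ P.colors} {c | c ∈ P.colors} where
  glob o g _ a _ := by simp [net, mem_colors, newInp, newAux]
  self o g _ a _ := by simp [net, mem_colors, newInp, newAux]
  other o g _ a _ b hb := by
    simp only [Set.mem_ofPred_eq, mem_colors] at hb
    simp [net, mem_colors, newAux, hb.1]

theorem initColor_mem (P : DynProgram) (n : ℕ) : P.initColor n ∈ P.colors := by
  simp [initColor, mem_colors]

/-- Domain sizes from `L` on are indistinguishable by formulas with code below `L`; both sizes are
compared with the domain `Fin L`. -/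
theorem initColor_stable (P : DynProgram) {L n : ℕ} (hL : 0 < L)
    (h : ∀ R < P.auxAr.length, (P.initFormula R).code < L) (hn : L ≤ n) :
    P.initColor n = P.initColor L := by
  refine Prod.ext rfl (List.map_congr_left fun R hR => ?_)
  have hc := h R (List.mem_range.1 hR)
  have key : ∀ m, L ≤ m → ((P.initFormula R).value (Fml.emptyConfig m) 0 0 = true ↔
      (P.initFormula R).Holds (D := Fin L) ⟨fun _ => ∅, fun _ => ∅⟩ fun _ => ⟨0, hL⟩) := by
    intro m hm
    have hm' : 0 < (Fml.emptyConfig m).2.length := by simp [Fml.emptyConfig]; omega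
    rw [Fml.value_eq_true_iff hm' hm']
    refine (Fml.holds_empty_iff_eval (K := L) (by simp; omega) hc (fun x _ => ?_)
      fun x _ y _ => ?_).symm
    · split_ifs <;> omega
    · simp
  rw [Bool.eq_iff_iff, key n hn, key L le_rfl]

/-- `g` gives the truth values of the nullary relations of the database `I`. -/
def NullaryValues (D : Type) (ar : List ℕ) (I : Database D) (g : List Bool) : Prop :=
  ∀ i, ar[i]? = some 0 → ([] ∈ I i ↔ g.getD i false = true)

/-- `c` gives the truth values of the unary relations of the database `I` at `d`. -/
def UnaryValues {D : Type} (ar : List ℕ) (I : Database D) (d : D) (c : List Bool) : Prop :=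
  ∀ i, ar[i]? = some 1 → ([d] ∈ I i ↔ c.getD i false = true)

end DynProgram

open DynProgram

theorem atomValue_iff {D : Type} {ar : List ℕ} {I : Database D} {g : List Bool}
    {l : List (List Bool)} (har : ∀ k ∈ ar, k ≤ 1) (hg : NullaryValues D ar I g) {args : List ℕ}
    {v : ℕ → D} {w : ℕ → ℕ} (hl : ∀ x ∈ args, UnaryValues ar I (v x) (l.getD (w x) []))
    {i : ℕ} (hi : ar[i]? = some args.length) :
    args.map v ∈ I i ↔ atomValue g l i (args.map w) = true := by
  match args, hi, hl with
  | [], hi, _ => simpa [atomValue] using hg i hi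
  | [x], hi, hl => simpa [atomValue] using hl x (by simp) i hi
  | _ :: _ :: _, hi, _ =>
    have := har _ (List.mem_of_getElem? hi)
    simp at this

/-- A quantifier-free formula has the same value in a state and in a configuration that describes
the part of the state to which the variables are mapped. -/
theorem Fml.holds_iff_eval {D : Type} {σ τ : List ℕ} (hσ : ∀ k ∈ σ, k ≤ 1) (hτ : ∀ k ∈ τ, k ≤ 1)
    {𝒮 : State D} {s : Config} (hg : NullaryValues D σ 𝒮.inputDB s.1.1)
    (hg' : NullaryValues D τ 𝒮.auxDB s.1.2) {φ : Fml} (hφ : φ.Over σ τ) (hqf : φ.QuantifierFree)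
    {v : ℕ → D} {w : ℕ → ℕ}
    (hvw : ∀ x ∈ φ.freeVars, ∀ y ∈ φ.freeVars, v x = v y ↔ w x = w y)
    (hl : ∀ x ∈ φ.freeVars, UnaryValues σ 𝒮.inputDB (v x) (s.2.getD (w x) ([], [])).1)
    (hl' : ∀ x ∈ φ.freeVars, UnaryValues τ 𝒮.auxDB (v x) (s.2.getD (w x) ([], [])).2) :
    φ.Holds 𝒮 v ↔ φ.Eval s w := by
  induction φ with
  | falsum => rfl
  | equal x y => exact hvw x (by simp [freeVars]) y (by simp [freeVars])
  | inp i args =>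
    refine atomValue_iff hσ hg (fun x hx => ?_) hφ
    rw [show ([] : List Bool) = Prod.fst (([], []) : Color) from rfl, List.getD_map]
    exact hl x (List.mem_toFinset.2 hx)
  | aux i args =>
    refine atomValue_iff hτ hg' (fun x hx => ?_) hφ
    rw [show ([] : List Bool) = Prod.snd (([], []) : Color) from rfl, List.getD_map]
    exact hl' x (List.mem_toFinset.2 hx)
  | imp φ ψ ih₁ ih₂ =>
    simp only [freeVars, Finset.mem_union] at hvw hl hl'
    simp only [Holds, Eval]
    rw [ih₁ hφ.1 hqf.1 (fun x hx y hy => hvw x (.inl hx) y (.inl hy)) (fun x hx => hl x (.inl hx))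
        fun x hx => hl' x (.inl hx),
      ih₂ hφ.2 hqf.2 (fun x hx y hy => hvw x (.inr hx) y (.inr hy)) (fun x hx => hl x (.inr hx))
        fun x hx => hl' x (.inr hx)]
  | all x φ => exact hqf.elim

/-! ### Simulation between program states and net configurations. -/

namespace DynProgram

variable {D : Type}

structure DescribesNullary (P : DynProgram) (𝒮 : State D) (g : Color) : Prop where
  inp : NullaryValues D P.inAr 𝒮.inputDB g.1
  aux : NullaryValues D P.auxAr 𝒮.auxDB g.2

structure DescribesUnary (P : DynProgram) (𝒮 : State D) (d : D) (c : Color) : Prop where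
  inp : UnaryValues P.inAr 𝒮.inputDB d c.1
  aux : UnaryValues P.auxAr 𝒮.auxDB d c.2

/-- The configuration `s` describes the state `𝒮` under the enumeration `e` of the domain. -/
structure Describes (P : DynProgram) {n : ℕ} (e : Fin n ≃ D) (𝒮 : State D) (s : Config) :
    Prop where
  length : s.2.length = n
  nullary : P.DescribesNullary 𝒮 s.1
  unary : ∀ j : Fin n, P.DescribesUnary 𝒮 (e j) (s.2.getD j ([], []))

/-- The Boolean that stands for a kind of operation in the transfer net. -/
def _root_.DynComplexity.OpKind.toBool : OpKind → Bool
  | .ins => true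
  | .del => false

theorem opFml_toBool (P : DynProgram) (o : OpKind) (S R : ℕ) :
    P.opFml (o.toBool, S) R = P.updateFml o S R := by
  cases o <;> rfl

/-- A quantifier-free formula sees only the elements named by its variables, so a window of two
letters replaces the whole word. `hpat` says that the window has the right equalities, `hcol` that
it has the right colours. -/
theorem sat_updateFml_iff [Nonempty D] {P : DynProgram} (hP : P.IsDynProp 1 1) {𝒮 : State D}
    {g a b : Color} (hg : P.DescribesNullary 𝒮 g) (o : OpKind) {S R : ℕ}
    (hS : S < P.inAr.length) (hR : R < P.auxAr.length) {u : List D}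
    (hc : u.length = P.inAr[S] + P.auxAr[R]) {w₀ w₁ : ℕ} (h₀ : w₀ < 2) (h₁ : w₁ < 2)
    (hpat : ∀ (x y : ℕ) (hx : x < u.length) (hy : y < u.length), u[x] = u[y] ↔
      (if x = 0 then w₀ else w₁) = if y = 0 then w₀ else w₁)
    (hcol : ∀ (x : ℕ) (hx : x < u.length), P.DescribesUnary 𝒮 u[x]
      ([a, b].getD (if x = 0 then w₀ else w₁) ([], []))) :
    (P.updateFml o S R).Sat 𝒮 u ↔
      (P.newAux (o.toBool, S) (g, [a, b]) w₀ w₁).getD R false = true := by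
  rw [newAux, getD_map_range, if_pos hR, opFml_toBool, Fml.value_eq_true_iff h₀ h₁]
  have hfv : ∀ x ∈ (P.updateFml o S R).freeVars, x < u.length := fun x hx =>
    hc ▸ hP.wellFormed.update_freeVars o S hS R hR x hx
  refine Fml.holds_iff_eval hP.inAr_le hP.auxAr_le hg.inp hg.aux
    (hP.wellFormed.update_over o S hS R hR) (hP.quantifierFree o S hS R hR) ?_ ?_ ?_
  · intro x hx y hy
    rw [List.getD_eq_getElem _ _ (hfv x hx), List.getD_eq_getElem _ _ (hfv y hy)]
    exact hpat x y (hfv x hx) (hfv y hy)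
  · intro x hx
    rw [List.getD_eq_getElem _ _ (hfv x hx)]
    exact (hcol x (hfv x hx)).inp
  · intro x hx
    rw [List.getD_eq_getElem _ _ (hfv x hx)]
    exact (hcol x (hfv x hx)).aux

open Classical in
theorem mem_apply_iff (δ : Modification D) (I : Database D) (i : ℕ) (b : List D) :
    b ∈ δ.apply I i ↔
      if i = δ.symb ∧ b = δ.tuple then δ.kind.toBool = true else b ∈ I i := by
  obtain ⟨k, S, t⟩ := δ
  rcases eq_or_ne i S with rfl | h
  · cases k <;> by_cases hb : b = t <;> simp [Modification.apply, OpKind.toBool, hb]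
  · simp [Modification.apply, h]

theorem getD_append_cons {C : Type} (l₁ : List C) (a : C) (l₂ : List C) (d : C) :
    (l₁ ++ a :: l₂).getD l₁.length d = a := by
  simp

theorem getD_next {Γ C O : Type} (N : TransferNet Γ C O) (o : O) (g : Γ) (l₁ : List C) (a : C)
    (l₂ : List C) (d : C) {j : ℕ} (hj : j < (l₁ ++ a :: l₂).length) (hne : j ≠ l₁.length) :
    (N.next o g l₁ a l₂).2.getD j d = N.other o g a ((l₁ ++ a :: l₂).getD j d) := by
  have h1 : j < (N.next o g l₁ a l₂).2.length := by
    simpa [TransferNet.next] using hj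
  rw [List.getD_eq_getElem _ _ hj, List.getD_eq_getElem _ _ h1]
  simp only [TransferNet.next, List.getElem_append, List.length_map]
  split_ifs with h
  · simp
  · obtain ⟨k, hk⟩ : ∃ k, j - l₁.length = k + 1 := ⟨j - l₁.length - 1, by omega⟩
    simp [hk]

/-- The single-step simulation, used in both directions. For a nullary operation the net still picks
a letter, but any letter will do. -/
theorem Describes.step [Nonempty D] {P : DynProgram} (hP : P.IsDynProp 1 1) {n : ℕ}
    {e : Fin n ≃ D} {𝒮 : State D} {g : Color} {l₁ l₂ : List Color} {a : Color}
    (h : P.Describes e 𝒮 (g, l₁ ++ a :: l₂)) {δ : Modification D} (hδ : P.Admissible δ)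
    (i : Fin n) (hi : (i : ℕ) = l₁.length) (ht : δ.tuple = [] ∨ δ.tuple = [e i]) :
    P.Describes e (P.step 𝒮 δ) (P.net.next (δ.kind.toBool, δ.symb) g l₁ a l₂) := by
  obtain ⟨hS, hS'⟩ := List.getElem?_eq_some_iff.1 hδ
  have hai : P.DescribesUnary 𝒮 (e i) a := by
    have := h.unary i
    rwa [hi, getD_append_cons] at this
  have hin : ∀ (k : ℕ) (hk : k < P.inAr.length) (c : List Bool),
      (P.newInp (δ.kind.toBool, δ.symb) c).getD k false =
        if k = δ.symb then δ.kind.toBool else c.getD k false := by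
    intro k hk c
    rw [newInp, getD_map_range, if_pos hk]
  have hlt : ∀ {ar : List ℕ} {k m : ℕ}, ar[k]? = some m → k < ar.length := fun h =>
    (List.getElem?_eq_some_iff.1 h).1
  have hmemi : ∀ (u : List D), (∀ d ∈ u, d = e i) → ∀ x (hx : x < u.length), u[x] = e i :=
    fun u hc x hx => hc _ (List.getElem_mem hx)
  -- Nullary symbols and the chosen element are handled together: in both cases every relevant
  -- variable denotes `e i`, whence the window `[a, a]`.
  have hauxi : ∀ R b, P.auxAr[R]? = some b.length → (∀ d ∈ δ.tuple ++ b, d = e i) →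
      (b ∈ (P.step 𝒮 δ).auxDB R ↔
        (P.newAux (δ.kind.toBool, δ.symb) (g, [a, a]) 0 0).getD R false = true) := by
    intro R b hb hall
    obtain ⟨hR, hR'⟩ := List.getElem?_eq_some_iff.1 hb
    rw [← sat_updateFml_iff hP h.nullary δ.kind hS hR (u := δ.tuple ++ b)
      (by rw [List.length_append, hS', hR']) (by norm_num) (by norm_num)]
    · simp [DynProgram.step, hb]
    · intro x y hx hy
      simp [hmemi _ hall x hx, hmemi _ hall y hy]
    · intro x hx
      rw [hmemi _ hall x hx]
      simpa using hai
  refine ⟨by simpa [TransferNet.next] using h.length, ⟨?_, ?_⟩, fun j => ?_⟩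
  · intro k hk
    change _ ↔ (P.newInp (δ.kind.toBool, δ.symb) g.1).getD k false = true
    rw [hin k (hlt hk)]
    change [] ∈ δ.apply 𝒮.inputDB k ↔ _
    rw [mem_apply_iff]
    by_cases hks : k = δ.symb
    · have : δ.tuple = [] := by
        subst hks
        rw [Admissible, hk] at hδ
        simpa using hδ.symm
      simp [hks, this]
    · simpa [hks] using h.nullary.inp k hk
  · intro R hR
    refine hauxi R [] hR fun d hd => ?_
    rcases ht with ht | ht <;> simp [ht] at hd
    exact hd
  · by_cases hji : j = i
    · subst hji
      have hself : (P.net.next (δ.kind.toBool, δ.symb) g l₁ a l₂).2.getD j ([], []) =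
          P.net.self (δ.kind.toBool, δ.symb) g a := by
        have := getD_append_cons (l₁.map (P.net.other (δ.kind.toBool, δ.symb) g a))
          (P.net.self (δ.kind.toBool, δ.symb) g a)
          (l₂.map (P.net.other (δ.kind.toBool, δ.symb) g a)) ([], [])
        rwa [List.length_map, ← hi] at this
      rw [hself]
      constructor
      · intro k hk
        change _ ↔ (P.newInp (δ.kind.toBool, δ.symb) a.1).getD k false = true
        rw [hin k (hlt hk)]
        change [e j] ∈ δ.apply 𝒮.inputDB k ↔ _
        rw [mem_apply_iff]
        by_cases hks : k = δ.symb
        · have : δ.tuple = [e j] := by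
            subst hks
            rw [Admissible, hk] at hδ
            rcases ht with ht | ht
            · simp [ht] at hδ
            · exact ht
          simp [hks, this]
        · simpa [hks] using hai.inp k hk
      · intro R hR
        refine hauxi R [e j] hR fun d hd => ?_
        rcases ht with ht | ht <;> simpa [ht] using hd
    · have hne : (j : ℕ) ≠ l₁.length := fun h' => hji (Fin.ext (h'.trans hi.symm))
      have hej : e j ≠ e i := fun h' => hji (e.injective h')
      rw [getD_next _ _ _ _ _ _ _ (by rw [h.length]; exact j.2) hne]
      set b := (l₁ ++ a :: l₂).getD (j : ℕ) (([], []) : Color) with hb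
      have hbj : P.DescribesUnary 𝒮 (e j) b := h.unary j
      constructor
      · intro k hk
        change [e j] ∈ δ.apply 𝒮.inputDB k ↔ b.1.getD k false = true
        rw [mem_apply_iff, if_neg]
        · exact hbj.inp k hk
        · rintro ⟨-, ht'⟩
          rcases ht with ht | ht <;> simp [ht] at ht'
          exact hji ht'
      · intro R hR
        change _ ↔ (P.newAux (δ.kind.toBool, δ.symb) (g, [a, b])
          (if P.inAr.getD δ.symb 0 = 0 then 1 else 0) 1).getD R false = true
        obtain ⟨hR', hR''⟩ := List.getElem?_eq_some_iff.1 hR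
        rw [List.getD_eq_getElem _ _ hS, hS']
        rw [← sat_updateFml_iff hP h.nullary δ.kind hS hR' (u := δ.tuple ++ [e j])
          (by rw [List.length_append, hS', hR'']; rfl) (by split_ifs <;> norm_num) (by norm_num)]
        · simp [DynProgram.step, hR]
        · intro x y hx hy
          rcases ht with ht | ht
          · simp [ht]
          · simp only [ht, List.length_append, List.length_singleton] at hx hy
            have hx' : x = 0 ∨ x = 1 := by omega
            have hy' : y = 0 ∨ y = 1 := by omega
            rcases hx' with rfl | rfl <;> rcases hy' with rfl | rfl <;> simp [ht, hej, hej.symm]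
        · intro x hx
          rcases ht with ht | ht
          · simpa [ht] using hbj
          · simp only [ht, List.length_append, List.length_singleton] at hx
            have hx' : x = 0 ∨ x = 1 := by omega
            rcases hx' with rfl | rfl
            · simpa [ht] using hai
            · simpa [ht] using hbj

/-- The initial configuration with `n` elements. -/
noncomputable def initConfig (P : DynProgram) (n : ℕ) : Config :=
  (P.initColor n, List.replicate n (P.initColor n))

/-- In the empty database all elements look alike, and an initialization formula has at most the
free variable `0`; one truth value per symbol therefore serves the global colour and all letters. -/
theorem describes_initState [Nonempty D] [Finite D] {P : DynProgram} (hP : P.IsDynProp 1 1)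
    {n : ℕ} (e : Fin n ≃ D) : P.Describes e (P.initState fun _ => ∅) (P.initConfig n) := by
  have hn : 0 < n := by
    obtain ⟨d⟩ := ‹Nonempty D›
    exact (e.symm d).pos
  have hin : ∀ k, (P.initColor n).1.getD k false = false := by
    intro k
    simp only [initColor, List.getD_eq_getElem?_getD, List.getElem?_replicate]
    split_ifs <;> rfl
  have haux : ∀ R b, P.auxAr[R]? = some b.length →
      (b ∈ (P.initState fun _ => (∅ : Set (List D))).auxDB R ↔
        (P.initColor n).2.getD R false = true) := by
    intro R b hb
    obtain ⟨hR, hR'⟩ := List.getElem?_eq_some_iff.1 hb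
    have hfv : ∀ x ∈ (P.initFormula R).freeVars, x = 0 := by
      intro x hx
      have h1 := hP.wellFormed.init_freeVars R hR x hx
      have h2 := hP.auxAr_le _ (List.getElem_mem hR)
      omega
    have hlen : 0 < (Fml.emptyConfig n).2.length := by simpa [Fml.emptyConfig] using hn
    rw [initColor, getD_map_range, if_pos hR, Fml.value_eq_true_iff hlen hlen]
    simp only [initState, Set.mem_ofPred_eq, hb, true_and]
    refine Fml.holds_empty_iff_eval (K := (P.initFormula R).code + 1) ?_ (Nat.lt_succ_self _) ?_ ?_
    · rw [← Nat.card_congr e, Nat.card_fin]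
    · intro x hx
      simpa using hn
    · intro x hx y hy
      simp [hfv x hx, hfv y hy]
  refine ⟨by simp [initConfig], ⟨fun k _ => ?_, fun R hR => haux R [] hR⟩, fun j => ?_⟩
  · simp only [initConfig, hin]
    simp [initState]
  · have hj : (P.initConfig n).2.getD j ([], []) = P.initColor n := by
      rw [List.getD_eq_getElem _ _ (by simp [initConfig])]
      simp [initConfig]
    rw [hj]
    refine ⟨fun k _ => ?_, fun R hR => haux R [e j] hR⟩
    rw [hin]
    simp [initState]

theorem Describes.auxDB_nonempty_iff [Nonempty D] {P : DynProgram} (hP : P.IsDynProp 1 1) {n : ℕ}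
    {e : Fin n ≃ D} {𝒮 : State D} {s : Config} (h : P.Describes e 𝒮 s)
    (h𝒮 : ∀ b ∈ 𝒮.auxDB P.query, P.auxAr[P.query]? = some b.length) :
    (𝒮.auxDB P.query).Nonempty ↔ P.net.Target s := by
  have hq := hP.wellFormed.query_lt
  have hle := hP.auxAr_le _ (List.getElem_mem hq)
  have hq' := List.getElem?_eq_getElem hq
  have hgoal : ∀ g c, P.net.goal g c ↔
      (if P.auxAr[P.query] = 0 then g else c).2.getD P.query false = true := by
    intro g c
    simp only [net]
    rw [List.getD_eq_getElem _ _ hq]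
  have hn : 0 < n := by
    obtain ⟨d⟩ := ‹Nonempty D›
    exact (e.symm d).pos
  simp only [TransferNet.Target, hgoal]
  rcases Nat.le_one_iff_eq_zero_or_eq_one.1 hle with h0 | h1
  · rw [h0] at hq'
    simp only [h0, if_true]
    rw [← h.nullary.aux _ hq']
    constructor
    · rintro ⟨b, hb⟩
      have : b = [] := by
        have := h𝒮 b hb
        rw [hq'] at this
        simpa using this.symm
      subst this
      -- The target condition asks for a letter even if the query is nullary; the non-empty domain
      -- supplies one.
      exact ⟨s.2[0]'(by rw [h.length]; exact hn), List.getElem_mem _, hb⟩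
    · rintro ⟨_, _, hb⟩
      exact ⟨_, hb⟩
  · rw [h1] at hq'
    simp only [h1, one_ne_zero, if_false]
    constructor
    · rintro ⟨b, hb⟩
      have hlen : b.length = 1 := by
        have := h𝒮 b hb
        rw [hq'] at this
        simpa using this.symm
      obtain ⟨d, rfl⟩ := List.length_eq_one_iff.1 hlen
      have := ((h.unary (e.symm d)).aux _ hq')
      rw [e.apply_symm_apply] at this
      have hlt : ((e.symm d : Fin n) : ℕ) < s.2.length := by rw [h.length]; exact (e.symm d).2
      rw [List.getD_eq_getElem _ _ hlt] at this
      exact ⟨_, List.getElem_mem hlt, this.1 hb⟩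
    · rintro ⟨c, hc, hc'⟩
      obtain ⟨j, hj, rfl⟩ := List.mem_iff_getElem.1 hc
      have := (h.unary ⟨j, h.length ▸ hj⟩).aux _ hq'
      rw [List.getD_eq_getElem _ _ hj] at this
      exact ⟨_, this.2 hc'⟩

theorem length_of_mem_reach [Nonempty D] (P : DynProgram) (α : List (Modification D)) {R : ℕ}
    {b : List D} (h : b ∈ (P.reach α).auxDB R) : P.auxAr[R]? = some b.length := by
  induction α using List.reverseRecOn with
  | nil => exact h.1
  | append_singleton α δ _ =>
    rw [reach, List.foldl_append] at h
    exact h.1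

theorem exists_describes_reach [Nonempty D] [Finite D] {P : DynProgram} (hP : P.IsDynProp 1 1)
    {n : ℕ} (e : Fin n ≃ D) (α : List (Modification D)) (hα : ∀ δ ∈ α, P.Admissible δ) :
    ∃ s, Relation.ReflTransGen P.net.Step (P.initConfig n) s ∧ P.Describes e (P.reach α) s := by
  induction α using List.reverseRecOn with
  | nil => exact ⟨_, .refl, describes_initState hP e⟩
  | append_singleton α δ ih =>
    obtain ⟨⟨g, l⟩, hs, hd⟩ := ih fun δ' h => hα δ' (by simp [h])
    have hδ := hα δ (by simp)
    obtain ⟨hS, hS'⟩ := List.getElem?_eq_some_iff.1 hδ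
    obtain ⟨i, hi⟩ : ∃ i : Fin n, δ.tuple = [] ∨ δ.tuple = [e i] := by
      have := hP.inAr_le _ (List.getElem_mem hS)
      rw [hS'] at this
      match hm : δ.tuple with
      -- A nullary modification names no element, so an arbitrary one is picked.
      | [] => exact ⟨e.symm (Classical.arbitrary D), .inl rfl⟩
      | [d] => exact ⟨e.symm d, .inr (by simp)⟩
      | _ :: _ :: _ => simp [hm] at this
    have hil : (i : ℕ) < l.length := by rw [hd.length]; exact i.2
    have hl : l = l.take i ++ l[i] :: l.drop (i + 1) := by simp
    rw [hl] at hd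
    have hd' := hd.step hP hδ i (by simp; omega) hi
    refine ⟨_, hs.tail ⟨(δ.kind.toBool, δ.symb), hS, l.take i, l[i], l.drop (i + 1), hl, rfl⟩, ?_⟩
    rw [reach, List.foldl_append]
    exact hd'

theorem exists_reach_describes {P : DynProgram} (hP : P.IsDynProp 1 1) {n : ℕ}
    [Nonempty (Fin n)] {s : Config} (h : Relation.ReflTransGen P.net.Step (P.initConfig n) s) :
    ∃ α : List (Modification (Fin n)), (∀ δ ∈ α, P.Admissible δ) ∧
      P.Describes (Equiv.refl (Fin n)) (P.reach α) s := by
  induction h with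
  | refl => exact ⟨[], by simp, describes_initState hP _⟩
  | @tail s t _ hst ih =>
    obtain ⟨α, hα, hd⟩ := ih
    obtain ⟨g, l⟩ := s
    obtain ⟨⟨b, S⟩, hS, l₁, a, l₂, rfl, rfl⟩ := hst
    replace hS : S < P.inAr.length := hS
    have hlt : l₁.length < n := by
      rw [← hd.length]
      simp
    have hle := hP.inAr_le _ (List.getElem_mem hS)
    obtain ⟨k, rfl⟩ : ∃ k : OpKind, b = k.toBool := by
      cases b
      exacts [⟨.del, rfl⟩, ⟨.ins, rfl⟩]
    obtain ⟨t, ht, ht'⟩ : ∃ t : List (Fin n), P.inAr[S]? = some t.length ∧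
        (t = [] ∨ t = [⟨l₁.length, hlt⟩]) := by
      rw [List.getElem?_eq_getElem hS]
      rcases Nat.le_one_iff_eq_zero_or_eq_one.1 hle with h0 | h1
      · exact ⟨[], by rw [h0]; rfl, .inl rfl⟩
      · exact ⟨_, by rw [h1]; rfl, .inr rfl⟩
    refine ⟨α ++ [⟨k, S, t⟩], fun δ hδ => ?_, ?_⟩
    · rcases List.mem_append.1 hδ with hδ | hδ
      · exact hα δ hδ
      · rw [List.mem_singleton.1 hδ]
        exact ht
    · rw [reach, List.foldl_append]
      exact hd.step hP (δ := ⟨k, S, t⟩) ht ⟨l₁.length, hlt⟩ rfl ht'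

/-- Net runs are realized over the domain `Fin n`; conversely, program runs over any finite domain
are transported along an enumeration of it. -/
theorem isEmpty_iff {P : DynProgram} (hP : P.IsDynProp 1 1) :
    P.IsEmpty ↔ ∀ n, 0 < n → ¬ P.net.CanReachTarget (P.initConfig n) := by
  constructor
  · rintro h n hn ⟨t, hst, ht⟩
    have : Nonempty (Fin n) := ⟨⟨0, hn⟩⟩
    obtain ⟨α, hα, hd⟩ := exists_reach_describes hP hst
    rw [← hd.auxDB_nonempty_iff hP fun b hb => length_of_mem_reach P α hb] at ht
    exact ht.ne_empty (h (Fin n) α hα)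
  · intro h D _ _ α hα
    by_contra hne
    have e := (Finite.equivFin D).symm
    obtain ⟨s, hs, hd⟩ := exists_describes_reach hP e α hα
    refine h _ Nat.card_pos ⟨s, hs, ?_⟩
    rw [← hd.auxDB_nonempty_iff hP fun b hb => length_of_mem_reach P α hb]
    exact Set.nonempty_iff_ne_empty.2 hne

end DynProgram

-- Closure properties of primitive recursive functions, set up for `fun_prop`.

attribute [fun_prop] Primrec Primrec.id Primrec.const Primrec.comp

section Primrec

variable {α β γ δ σ : Type} [Primcodable α] [Primcodable β] [Primcodable γ] [Primcodable δ]
  [Primcodable σ]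

@[fun_prop]
theorem primrec_fst {f : α → β × γ} (hf : Primrec f) : Primrec fun a => (f a).1 :=
  Primrec.fst.comp hf

@[fun_prop]
theorem primrec_snd {f : α → β × γ} (hf : Primrec f) : Primrec fun a => (f a).2 :=
  Primrec.snd.comp hf

@[fun_prop]
theorem primrec_mk {f : α → β} {g : α → γ} (hf : Primrec f) (hg : Primrec g) :
    Primrec fun a => (f a, g a) :=
  Primrec.pair hf hg

@[fun_prop]
theorem primrec_add {f g : α → ℕ} (hf : Primrec f) (hg : Primrec g) :
    Primrec fun a => f a + g a :=
  Primrec.nat_add.comp hf hg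

@[fun_prop]
theorem primrec_sub {f g : α → ℕ} (hf : Primrec f) (hg : Primrec g) :
    Primrec fun a => f a - g a :=
  Primrec.nat_sub.comp hf hg

@[fun_prop]
theorem primrec_div {f g : α → ℕ} (hf : Primrec f) (hg : Primrec g) :
    Primrec fun a => f a / g a :=
  Primrec.nat_div.comp hf hg

@[fun_prop]
theorem primrec_mod {f g : α → ℕ} (hf : Primrec f) (hg : Primrec g) :
    Primrec fun a => f a % g a :=
  Primrec.nat_mod.comp hf hg

@[fun_prop]
theorem primrec_unpair {f : α → ℕ} (hf : Primrec f) : Primrec fun a => (f a).unpair :=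
  Primrec.unpair.comp hf

@[fun_prop]
theorem primrec_ofNat_list {f : α → ℕ} (hf : Primrec f) :
    Primrec fun a => Denumerable.ofNat (List ℕ) (f a) :=
  (Primrec.ofNat (List ℕ)).comp hf

@[fun_prop]
theorem primrec_encode {f : α → β} (hf : Primrec f) : Primrec fun a => Encodable.encode (f a) :=
  Primrec.encode.comp hf

@[fun_prop]
theorem primrec_and {f g : α → Bool} (hf : Primrec f) (hg : Primrec g) :
    Primrec fun a => f a && g a :=
  Primrec.and.comp hf hg

@[fun_prop]
theorem primrec_or {f g : α → Bool} (hf : Primrec f) (hg : Primrec g) :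
    Primrec fun a => f a || g a :=
  Primrec.or.comp hf hg

@[fun_prop]
theorem primrec_not {f : α → Bool} (hf : Primrec f) : Primrec fun a => !f a :=
  Primrec.not.comp hf

@[fun_prop]
theorem primrec_decide_eq [DecidableEq β] {f g : α → β} (hf : Primrec f) (hg : Primrec g) :
    Primrec fun a => decide (f a = g a) :=
  (Primrec.eq.comp hf hg).decide

@[fun_prop]
theorem primrec_beq [BEq β] [LawfulBEq β] {f g : α → β} (hf : Primrec f) (hg : Primrec g) :
    Primrec fun a => f a == g a := by
  classical
  exact (primrec_decide_eq hf hg).of_eq fun _ => by rw [Bool.eq_iff_iff]; simp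

@[fun_prop]
theorem primrec_decide_lt {f g : α → ℕ} (hf : Primrec f) (hg : Primrec g) :
    Primrec fun a => decide (f a < g a) :=
  (Primrec.nat_lt.comp hf hg).decide

@[fun_prop]
theorem primrec_ite {c : α → Prop} [DecidablePred c] {f g : α → β}
    (hc : Primrec fun a => decide (c a)) (hf : Primrec f) (hg : Primrec g) :
    Primrec fun a => if c a then f a else g a :=
  Primrec.ite hc.primrecPred hf hg

@[fun_prop]
theorem primrec_decide_eq_true {f : α → Bool} (hf : Primrec f) :
    Primrec fun a => decide (f a = true) :=
  hf.of_eq fun _ => by simp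

@[fun_prop]
theorem primrec_cons {f : α → β} {g : α → List β} (hf : Primrec f) (hg : Primrec g) :
    Primrec fun a => f a :: g a :=
  Primrec.list_cons.comp hf hg

@[fun_prop]
theorem primrec_append {f g : α → List β} (hf : Primrec f) (hg : Primrec g) :
    Primrec fun a => f a ++ g a :=
  Primrec.list_append.comp hf hg

@[fun_prop]
theorem primrec_length {f : α → List β} (hf : Primrec f) : Primrec fun a => (f a).length :=
  Primrec.list_length.comp hf

@[fun_prop]
theorem primrec_headI {f : α → List ℕ} (hf : Primrec f) : Primrec fun a => (f a).headI :=
  Primrec.list_headI.comp hf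

@[fun_prop]
theorem primrec_getD {f : α → List β} {g : α → ℕ} {d : β} (hf : Primrec f) (hg : Primrec g) :
    Primrec fun a => (f a).getD (g a) d :=
  (Primrec.list_getD d).comp hf hg

@[fun_prop]
theorem primrec_set {f : α → List β} {g : α → ℕ} {h : α → β} (hf : Primrec f) (hg : Primrec g)
    (hh : Primrec h) : Primrec fun a => (f a).set (g a) (h a) :=
  Primrec.list_set.comp hf (hg.pair hh)

@[fun_prop]
theorem primrec_take {f : α → List β} {g : α → ℕ} (hf : Primrec f) (hg : Primrec g) :
    Primrec fun a => (f a).take (g a) :=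
  Primrec.list_take.comp hg hf

@[fun_prop]
theorem primrec_drop {f : α → List β} {g : α → ℕ} (hf : Primrec f) (hg : Primrec g) :
    Primrec fun a => (f a).drop (g a) :=
  Primrec.list_drop.comp hg hf

@[fun_prop]
theorem primrec_range {f : α → ℕ} (hf : Primrec f) : Primrec fun a => List.range (f a) :=
  Primrec.list_range.comp hf

@[fun_prop]
theorem primrec_map {f : α → List β} {g : α → β → γ} (hf : Primrec f)
    (hg : Primrec fun x : α × β => g x.1 x.2) : Primrec fun a => (f a).map (g a) :=
  Primrec.list_map hf hg

@[fun_prop]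
theorem primrec_flatMap {f : α → List β} {g : α → β → List γ} (hf : Primrec f)
    (hg : Primrec fun x : α × β => g x.1 x.2) : Primrec fun a => (f a).flatMap (g a) :=
  Primrec.list_flatMap hf hg

@[fun_prop]
theorem primrec_replicate {f : α → ℕ} {g : α → β} (hf : Primrec f) (hg : Primrec g) :
    Primrec fun a => List.replicate (f a) (g a) :=
  (primrec_map (primrec_range hf) (g := fun a _ => g a) (by fun_prop)).of_eq fun a => by
    simp [List.map_const']

@[fun_prop]
theorem primrec_filter {f : α → List β} {p : α → β → Bool} (hf : Primrec f)
    (hp : Primrec fun x : α × β => p x.1 x.2) : Primrec fun a => (f a).filter (p a) :=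
  (primrec_flatMap hf (g := fun a b => if p a b then [b] else []) (by fun_prop)).of_eq fun a => by
    induction f a with
    | nil => rfl
    | cons b l ih => by_cases h : p a b <;> simp [ih, h]

@[fun_prop]
theorem primrec_any {f : α → List β} {p : α → β → Bool} (hf : Primrec f)
    (hp : Primrec fun x : α × β => p x.1 x.2) : Primrec fun a => (f a).any (p a) :=
  (Primrec.list_foldr (h := fun a x => p a x.1 || x.2) hf (Primrec.const false)
    (show Primrec _ from Primrec.or.comp
      (hp.comp (Primrec.fst.pair (Primrec.fst.comp Primrec.snd)))
      (Primrec.snd.comp Primrec.snd))).of_eq fun a => by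
    induction f a with
    | nil => rfl
    | cons b l ih => simp [ih]

@[fun_prop]
theorem primrec_all {f : α → List β} {p : α → β → Bool} (hf : Primrec f)
    (hp : Primrec fun x : α × β => p x.1 x.2) : Primrec fun a => (f a).all (p a) :=
  (primrec_not (primrec_any hf (p := fun a b => !p a b) (primrec_not hp))).of_eq fun a => by
    simp [List.all_eq_not_any_not]

@[fun_prop]
theorem primrec_contains [BEq β] [LawfulBEq β] {f : α → List β} {g : α → β} (hf : Primrec f)
    (hg : Primrec g) : Primrec fun a => (f a).contains (g a) :=
  (primrec_any hf (p := fun a b => g a == b) (by fun_prop)).of_eq fun a => by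
    rw [List.contains_eq_any_beq]

@[fun_prop]
theorem primrec_foldl {f : α → List β} {s : α → γ} {h : α → γ → β → γ} (hf : Primrec f)
    (hs : Primrec s) (hh : Primrec fun x : α × γ × β => h x.1 x.2.1 x.2.2) :
    Primrec fun a => (f a).foldl (h a) (s a) :=
  Primrec.list_foldl (h := fun a x => h a x.1 x.2) hf hs hh

@[fun_prop]
theorem primrec_words {A : α → List β} {n : α → ℕ} (hA : Primrec A) (hn : Primrec n) :
    Primrec fun a => words (A a) (n a) :=
  (Primrec.nat_rec' (f := n) (g := fun _ => [[]])
    (h := fun a x => (A a).flatMap fun b => x.2.map fun l => b :: l) hn (Primrec.const _)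
    (show Primrec fun x : α × ℕ × List (List β) =>
      (A x.1).flatMap fun b => x.2.2.map fun l => b :: l by fun_prop)).of_eq fun a => by
    induction n a with
    | zero => rfl
    | succ n ih => simp only [words, ih]

@[fun_prop]
theorem primrec_atomValue {g : α → List Bool} {l : α → List (List Bool)} {i : α → ℕ}
    {args : α → List ℕ} (hg : Primrec g) (hl : Primrec l) (hi : Primrec i)
    (hargs : Primrec args) : Primrec fun a => atomValue (g a) (l a) (i a) (args a) := by
  unfold atomValue
  fun_prop

/-- A predicate that asks for a certificate accepted by a primitive recursive check is
recursively enumerable. -/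
theorem rePred_exists {p : α → β → Bool} (hp : Primrec fun x : α × β => p x.1 x.2) :
    REPred fun a => ∃ b, p a b = true := by
  have h : Computable₂ fun (a : α) (n : ℕ) =>
      (Encodable.decode (α := β) n).bind fun b => if p a b = true then some () else none := by
    refine (Primrec.option_bind (Primrec.decode.comp Primrec.snd) ?_).to_comp
    exact primrec_ite (primrec_decide_eq_true
      (hp.comp ((Primrec.fst.comp Primrec.fst).pair Primrec.snd))) (Primrec.const _)
      (Primrec.const _)
  refine (Partrec.rfindOpt h).dom_re.of_eq fun a => ?_
  -- The unbounded search through codes of certificates halts exactly when an accepted one exists.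
  rw [Nat.rfindOpt_dom]
  constructor
  · rintro ⟨n, u, hu⟩
    simp only [Option.mem_def, Option.bind_eq_some_iff] at hu
    obtain ⟨b, -, hb⟩ := hu
    refine ⟨b, ?_⟩
    by_contra hne
    simp [hne] at hb
  · rintro ⟨b, hb⟩
    exact ⟨Encodable.encode b, (), by simp [hb]⟩

end Primrec

/-! ### Formula evaluation is primitive recursive. -/

namespace Fml

/-- Whether the assignment `v` satisfies a formula with code `5 * Nat.pair i j + r + 1`, given the
list `T` of the tables of all formulas with smaller codes. -/
def tableTest (s : Config) (r i j : ℕ) (T : List (List (List ℕ))) (v : List ℕ) : Bool :=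
  if r = 0 then v.getD i 0 == v.getD j 0
  else if r = 1 then atomValue s.1.1 (s.2.map fun c => c.1) i
    ((Denumerable.ofNat (List ℕ) j).map fun x => v.getD x 0)
  else if r = 2 then atomValue s.1.2 (s.2.map fun c => c.2) i
    ((Denumerable.ofNat (List ℕ) j).map fun x => v.getD x 0)
  else if r = 3 then !(T.getD i []).contains v || (T.getD j []).contains v
  else (List.range s.2.length).all fun d => (T.getD j []).contains (v.set i d)

theorem primrec_tableTest {α : Type} [Primcodable α] {s : α → Config} {r i j : α → ℕ}
    {T : α → List (List (List ℕ))} {v : α → List ℕ} (hs : Primrec s) (hr : Primrec r)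
    (hi : Primrec i) (hj : Primrec j) (hT : Primrec T) (hv : Primrec v) :
    Primrec fun a => tableTest (s a) (r a) (i a) (j a) (T a) (v a) := by
  unfold tableTest
  refine primrec_ite (by fun_prop) (by fun_prop) (primrec_ite (by fun_prop) (by fun_prop)
    (primrec_ite (by fun_prop) (by fun_prop) (primrec_ite (by fun_prop) (by fun_prop)
      (by fun_prop))))

/-- The table of a formula whose code is the length of the list `T`, given that `T` consists of the
tables of all formulas with smaller codes. -/
def tableStep (s : Config) (K : ℕ) (T : List (List (List ℕ))) : List (List ℕ) :=
  if T.length = 0 then []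
  else (words (List.range s.2.length) K).filter
    (tableTest s ((T.length - 1) % 5) ((T.length - 1) / 5).unpair.1
      ((T.length - 1) / 5).unpair.2 T)

theorem primrec_tableStep :
    Primrec fun x : (Config × ℕ) × List (List (List ℕ)) => tableStep x.1.1 x.1.2 x.2 := by
  unfold tableStep
  refine primrec_ite (by fun_prop) (by fun_prop) (primrec_filter (by fun_prop) ?_)
  exact primrec_tableTest (by fun_prop) (by fun_prop) (by fun_prop) (by fun_prop) (by fun_prop)
    (by fun_prop)

/-- For a nonzero code `c`, the residue of `c - 1` modulo `5` is the constructor and the quotient is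
the pair of its arguments. Codes of subformulas are smaller, so their tables are already in `T`. -/
theorem tableStep_eq {s : Config} {K : ℕ} {φ : Fml} {T : List (List (List ℕ))}
    (hlen : T.length = φ.code) (hT : ∀ ψ : Fml, ψ.code < φ.code → T.getD ψ.code [] = ψ.table s K) :
    tableStep s K T = φ.table s K := by
  have hdiv : ∀ m, (5 * m + 1 - 1) / 5 = m ∧ (5 * m + 2 - 1) / 5 = m ∧ (5 * m + 3 - 1) / 5 = m ∧
      (5 * m + 4 - 1) / 5 = m ∧ (5 * m + 5 - 1) / 5 = m := fun m => by omega
  have hmod : ∀ m, (5 * m + 1 - 1) % 5 = 0 ∧ (5 * m + 2 - 1) % 5 = 1 ∧ (5 * m + 3 - 1) % 5 = 2 ∧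
      (5 * m + 4 - 1) % 5 = 3 ∧ (5 * m + 5 - 1) % 5 = 4 := fun m => by omega
  cases φ with
  | falsum =>
    rw [tableStep, if_pos (by rw [hlen]; rfl)]
    rfl
  | equal x y =>
    rw [tableStep, if_neg (by rw [hlen, code]; omega), hlen, code, (hdiv _).1, (hmod _).1]
    exact List.filter_congr fun v _ => by simp [tableTest]
  | inp i args =>
    rw [tableStep, if_neg (by rw [hlen, code]; omega), hlen, code, (hdiv _).2.1, (hmod _).2.1]
    exact List.filter_congr fun v _ => by simp [tableTest]
  | aux i args =>
    rw [tableStep, if_neg (by rw [hlen, code]; omega), hlen, code, (hdiv _).2.2.1, (hmod _).2.2.1]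
    exact List.filter_congr fun v _ => by simp [tableTest]
  | imp φ ψ =>
    have h1 := Nat.left_le_pair φ.code ψ.code
    have h2 := Nat.right_le_pair φ.code ψ.code
    rw [tableStep, if_neg (by rw [hlen, code]; omega), hlen, code, (hdiv _).2.2.2.1,
      (hmod _).2.2.2.1]
    rw [Nat.unpair_pair]
    exact List.filter_congr fun v _ => by
      rw [tableTest, hT φ (by rw [code]; omega), hT ψ (by rw [code]; omega)]
      simp
  | all x φ =>
    have h2 := Nat.right_le_pair x φ.code
    rw [tableStep, if_neg (by rw [hlen, code]; omega), hlen, code, (hdiv _).2.2.2.2,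
      (hmod _).2.2.2.2]
    rw [Nat.unpair_pair]
    exact List.filter_congr fun v _ => by
      rw [tableTest, hT φ (by rw [code]; omega)]
      simp

/-- The formula with a given code. -/
noncomputable def ofCode : ℕ → Fml := Function.surjInv code_surjective

theorem code_ofCode (n : ℕ) : (ofCode n).code = n := Function.surjInv_eq code_surjective n

theorem ofCode_code (φ : Fml) : ofCode φ.code = φ := code_injective (code_ofCode _)

/-- Structural recursion on formulas becomes course-of-values recursion on codes; the noncomputable
`ofCode` occurs only in the specification. -/
theorem primrec_table_ofCode :
    Primrec₂ fun (a : Config × ℕ) (n : ℕ) => (ofCode n).table a.1 a.2 := by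
  refine Primrec.nat_strong_rec _ (g := fun a T => some (tableStep a.1 a.2 T))
    (Primrec.option_some.comp primrec_tableStep) fun a n => ?_
  rw [Option.some_inj]
  refine tableStep_eq (by simp [code_ofCode]) fun ψ hψ => ?_
  rw [code_ofCode] at hψ
  rw [getD_map_range, if_pos hψ, ofCode_code]

end Fml

section Primrec

variable {α : Type} [Primcodable α]

@[fun_prop]
theorem primrec_value {s : α → Config} {φ : α → Fml} {w₀ w₁ : α → ℕ} (hs : Primrec s)
    (hφ : Primrec φ) (h₀ : Primrec w₀) (h₁ : Primrec w₁) :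
    Primrec fun a => (φ a).value (s a) (w₀ a) (w₁ a) := by
  have h : Primrec fun a => (φ a).table (s a) (Encodable.encode (φ a) + 1) :=
    (Fml.primrec_table_ofCode.comp
      (show Primrec fun a => (s a, Encodable.encode (φ a) + 1) by fun_prop)
      (primrec_encode hφ)).of_eq fun a => by
      rw [Fml.encode_eq_code, Fml.ofCode_code]
  unfold Fml.value
  fun_prop

@[fun_prop]
theorem primrec_emptyConfig {n : α → ℕ} (hn : Primrec n) :
    Primrec fun a => Fml.emptyConfig (n a) := by
  unfold Fml.emptyConfig
  fun_prop

end Primrec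

/-! ### The net of a program is primitive recursive. -/

namespace DynProgram

section Primrec

variable {α : Type} [Primcodable α] {P : α → DynProgram} {o : α → Bool × ℕ}

theorem primrec_equivProd (hP : Primrec P) : Primrec fun a => equivProd (P a) :=
  Primrec.of_equiv.comp hP

@[fun_prop]
theorem primrec_inAr (hP : Primrec P) : Primrec fun a => (P a).inAr :=
  primrec_fst (primrec_equivProd hP)

@[fun_prop]
theorem primrec_auxAr (hP : Primrec P) : Primrec fun a => (P a).auxAr :=
  primrec_fst (primrec_snd (primrec_equivProd hP))

@[fun_prop]
theorem primrec_insFml (hP : Primrec P) : Primrec fun a => (P a).insFml :=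
  primrec_fst (primrec_snd (primrec_snd (primrec_equivProd hP)))

@[fun_prop]
theorem primrec_delFml (hP : Primrec P) : Primrec fun a => (P a).delFml :=
  primrec_fst (primrec_snd (primrec_snd (primrec_snd (primrec_equivProd hP))))

@[fun_prop]
theorem primrec_initFml (hP : Primrec P) : Primrec fun a => (P a).initFml :=
  primrec_fst (primrec_snd (primrec_snd (primrec_snd (primrec_snd (primrec_equivProd hP)))))

@[fun_prop]
theorem primrec_query (hP : Primrec P) : Primrec fun a => (P a).query :=
  primrec_snd (primrec_snd (primrec_snd (primrec_snd (primrec_snd (primrec_equivProd hP)))))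

@[fun_prop]
theorem primrec_initFormula {R : α → ℕ} (hP : Primrec P) (hR : Primrec R) :
    Primrec fun a => (P a).initFormula (R a) := by
  unfold initFormula
  fun_prop

@[fun_prop]
theorem primrec_newInp {c : α → List Bool} (hP : Primrec P) (ho : Primrec o) (hc : Primrec c) :
    Primrec fun a => (P a).newInp (o a) (c a) := by
  unfold newInp
  fun_prop

@[fun_prop]
theorem primrec_newAux {s : α → Config} {w₀ w₁ : α → ℕ} (hP : Primrec P) (ho : Primrec o)
    (hs : Primrec s) (h₀ : Primrec w₀) (h₁ : Primrec w₁) :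
    Primrec fun a => (P a).newAux (o a) (s a) (w₀ a) (w₁ a) := by
  unfold newAux opFml
  fun_prop

@[fun_prop]
theorem primrec_initConfig {n : α → ℕ} (hP : Primrec P) (hn : Primrec n) :
    Primrec fun a => (P a).initConfig (n a) := by
  unfold initConfig initColor
  fun_prop

@[fun_prop]
theorem primrec_colors (hP : Primrec P) : Primrec fun a => (P a).colors := by
  unfold colors
  fun_prop

@[fun_prop]
theorem primrec_next {g a : α → Color} {l₁ l₂ : α → List Color} (hP : Primrec P)
    (ho : Primrec o) (hg : Primrec g) (hl₁ : Primrec l₁) (ha : Primrec a) (hl₂ : Primrec l₂) :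
    Primrec fun x => (P x).net.next (o x) (g x) (l₁ x) (a x) (l₂ x) := by
  simp only [TransferNet.next, net]
  fun_prop

end Primrec

end DynProgram

/-! ### Checkable witnesses for reachability and for unreachability. -/

namespace DynProgram

/-- The goal of the transfer net as a Boolean. -/
def goalTest (P : DynProgram) (g c : Color) : Bool :=
  (if P.auxAr.getD P.query 0 = 0 then g else c).2.getD P.query false

theorem goalTest_eq_true_iff {P : DynProgram} {g c : Color} :
    P.goalTest g c = true ↔ P.net.goal g c := Iff.rfl

def ops (P : DynProgram) : List (Bool × ℕ) :=
  [true, false].flatMap fun b => (List.range P.inAr.length).map fun S => (b, S)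

theorem mem_ops {P : DynProgram} {o : Bool × ℕ} : o ∈ P.ops ↔ P.net.op o := by
  obtain ⟨b, S⟩ := o
  cases b <;> simp [ops, net]

def goalCheck (P : DynProgram) (W : List Config) : Bool :=
  P.colors.all fun g => P.colors.all fun c => !P.goalTest g c || W.contains (g, [c])

noncomputable def stepCheck (P : DynProgram) (W : List Config) (g a : Color)
    (l₁ l₂ : List Color) : Bool :=
  W.contains (g, l₁ ++ a :: l₂) || (!W.contains (g, l₁ ++ l₂) &&
    P.ops.all fun o => !W.contains (P.net.next o g l₁ a l₂))

noncomputable def closureCheck (P : DynProgram) (L : ℕ) (W : List Config) : Bool :=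
  P.colors.all fun g => P.colors.all fun a =>
    (List.range L).all fun n => (List.range (L - n)).all fun m =>
      (words P.colors n).all fun l₁ => (words P.colors m).all fun l₂ => P.stepCheck W g a l₁ l₂

def shrinkCheck (P : DynProgram) (L : ℕ) (W : List Config) : Bool :=
  P.colors.all fun g => (words P.colors L).all fun l =>
    !W.contains (g, l) || (List.range L).any fun e => W.contains (g, l.take e ++ l.drop (e + 1))

noncomputable def initCheck (P : DynProgram) (L : ℕ) (W : List Config) : Bool :=
  decide (0 < L) &&
    (List.range P.auxAr.length).all (fun R => decide (Encodable.encode (P.initFormula R) < L)) &&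
    (List.range L).all fun n => !W.contains (P.initConfig (n + 1))

/-- The check that `p.2` lists the configurations of length at most `p.1` of a set which certifies
emptiness. -/
noncomputable def safeCheck (P : DynProgram) (p : ℕ × List Config) : Bool :=
  (P.goalCheck p.2 && P.closureCheck p.1 p.2) && (P.shrinkCheck p.1 p.2 && P.initCheck p.1 p.2)

/-- The configuration reached when an operation is applied to the element at a given position. -/
noncomputable def stepFn (P : DynProgram) (s : Config) (p : (Bool × ℕ) × ℕ) : Config :=
  if p.1.2 < P.inAr.length then
    if p.2 < s.2.length then
      P.net.next p.1 s.1 (s.2.take p.2) (s.2.getD p.2 ([], [])) (s.2.drop (p.2 + 1))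
    else s
  else s

/-- The check that the operations `p.2` lead to the goal from the initial configuration with
`p.1 + 1` elements. -/
noncomputable def reachCheck (P : DynProgram) (p : ℕ × List ((Bool × ℕ) × ℕ)) : Bool :=
  (p.2.foldl P.stepFn (P.initConfig (p.1 + 1))).2.any fun c =>
    P.goalTest (p.2.foldl P.stepFn (P.initConfig (p.1 + 1))).1 c

section Primrec

variable {α : Type} [Primcodable α] {P : α → DynProgram}

@[fun_prop]
theorem primrec_goalTest {g c : α → Color} (hP : Primrec P) (hg : Primrec g) (hc : Primrec c) :
    Primrec fun a => (P a).goalTest (g a) (c a) := by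
  unfold goalTest
  fun_prop

@[fun_prop]
theorem primrec_ops (hP : Primrec P) : Primrec fun a => (P a).ops := by
  unfold ops
  fun_prop

@[fun_prop]
theorem primrec_goalCheck {W : α → List Config} (hP : Primrec P) (hW : Primrec W) :
    Primrec fun a => (P a).goalCheck (W a) := by
  unfold goalCheck
  fun_prop

@[fun_prop]
theorem primrec_stepCheck {W : α → List Config} {g a : α → Color} {l₁ l₂ : α → List Color}
    (hP : Primrec P) (hW : Primrec W) (hg : Primrec g) (ha : Primrec a) (hl₁ : Primrec l₁)
    (hl₂ : Primrec l₂) : Primrec fun x => (P x).stepCheck (W x) (g x) (a x) (l₁ x) (l₂ x) := by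
  unfold stepCheck
  fun_prop

@[fun_prop]
theorem primrec_closureCheck {L : α → ℕ} {W : α → List Config} (hP : Primrec P)
    (hL : Primrec L) (hW : Primrec W) : Primrec fun a => (P a).closureCheck (L a) (W a) := by
  unfold closureCheck
  fun_prop

@[fun_prop]
theorem primrec_shrinkCheck {L : α → ℕ} {W : α → List Config} (hP : Primrec P)
    (hL : Primrec L) (hW : Primrec W) : Primrec fun a => (P a).shrinkCheck (L a) (W a) := by
  unfold shrinkCheck
  fun_prop

@[fun_prop]
theorem primrec_initCheck {L : α → ℕ} {W : α → List Config} (hP : Primrec P)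
    (hL : Primrec L) (hW : Primrec W) : Primrec fun a => (P a).initCheck (L a) (W a) := by
  unfold initCheck
  fun_prop

theorem primrec_safeCheck :
    Primrec fun x : DynProgram × (ℕ × List Config) => x.1.safeCheck x.2 := by
  unfold safeCheck
  fun_prop

@[fun_prop]
theorem primrec_stepFn {s : α → Config} {p : α → (Bool × ℕ) × ℕ} (hP : Primrec P)
    (hs : Primrec s) (hp : Primrec p) : Primrec fun a => (P a).stepFn (s a) (p a) := by
  unfold stepFn
  fun_prop

theorem primrec_reachCheck :
    Primrec fun x : DynProgram × (ℕ × List ((Bool × ℕ) × ℕ)) => x.1.reachCheck x.2 := by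
  unfold reachCheck
  fun_prop

end Primrec

/-- A run is encoded by its operations and positions. `stepFn` stays put on invalid moves, so every
list encodes some run; the shift by one in the length excludes the empty domain. -/
theorem exists_reachCheck_iff (P : DynProgram) :
    (∃ p, P.reachCheck p = true) ↔ ∃ n, 0 < n ∧ P.net.CanReachTarget (P.initConfig n) := by
  have htarget : ∀ p : ℕ × List ((Bool × ℕ) × ℕ), P.reachCheck p = true ↔
      P.net.Target (p.2.foldl P.stepFn (P.initConfig (p.1 + 1))) := by
    intro p
    simp only [reachCheck, List.any_eq_true, goalTest_eq_true_iff]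
    rfl
  constructor
  · rintro ⟨⟨n, α⟩, h⟩
    refine ⟨n + 1, n.succ_pos, _, ?_, (htarget _).1 h⟩
    clear h
    induction α using List.reverseRecOn with
    | nil => exact .refl
    | append_singleton α p ih =>
      rw [List.foldl_append]
      refine ih.trans ?_
      simp only [List.foldl_cons, List.foldl_nil]
      generalize α.foldl P.stepFn (P.initConfig (n + 1)) = s
      rw [stepFn]
      split_ifs with h1 h2
      · refine .single ⟨p.1, h1, _, _, _, ?_, rfl⟩
        rw [List.getD_eq_getElem _ _ h2]
        simp
      · exact .refl
      · exact .refl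
  · rintro ⟨n, hn, t, hst, ht⟩
    suffices h : ∃ α : List ((Bool × ℕ) × ℕ), α.foldl P.stepFn (P.initConfig n) = t by
      obtain ⟨α, rfl⟩ := h
      refine ⟨(n - 1, α), (htarget _).2 ?_⟩
      rwa [Nat.sub_add_cancel hn]
    clear ht
    induction hst with
    | refl => exact ⟨[], rfl⟩
    | @tail s t _ hst ih =>
      obtain ⟨α, hα⟩ := ih
      obtain ⟨g, l⟩ := s
      obtain ⟨o, ho, l₁, a, l₂, rfl, rfl⟩ := hst
      refine ⟨α ++ [(o, l₁.length)], ?_⟩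
      rw [List.foldl_append, hα, List.foldl_cons, List.foldl_nil, stepFn,
        if_pos (show (o, l₁.length).1.2 < P.inAr.length from ho),
        if_pos (by simp), getD_append_cons]
      simp

theorem certificate_of_safeCheck {P : DynProgram} {L : ℕ} {W : List Config}
    (h : P.safeCheck (L, W) = true) :
    (∀ R < P.auxAr.length, (P.initFormula R).code < L) ∧
      P.net.Certificate {c | c ∈ P.colors} {c | c ∈ P.colors} P.initColor P.initColor L
        (· ∈ W) := by
  simp only [safeCheck, goalCheck, closureCheck, stepCheck, shrinkCheck, initCheck,
    Bool.and_eq_true, List.all_eq_true, List.any_eq_true, Bool.or_eq_true, Bool.not_eq_true',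
    List.contains_eq_mem, decide_eq_true_eq, decide_eq_false_iff_not, List.mem_range] at h
  obtain ⟨⟨hgoal, hclos⟩, hshrink, ⟨hpos, hcode⟩, hinit⟩ := h
  refine ⟨hcode, hpos, fun g hg c hc hgc => ?_, fun g hg a ha l₁ l₂ h₁ h₂ hlt hW => ?_,
    fun g hg a ha l₁ l₂ h₁ h₂ hlt o ho hW => ?_, fun g hg l hl hlen hW => ?_,
    fun n hn hnL => ?_⟩
  · exact (hgoal g hg c hc).resolve_left (by simpa [goalTest_eq_true_iff] using hgc)
  · exact (hclos g hg a ha _ (by omega) l₂.length (by omega) l₁ (mem_words.2 ⟨rfl, h₁⟩) l₂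
      (mem_words.2 ⟨rfl, h₂⟩)).resolve_right fun h => h.1 hW
  · exact (hclos g hg a ha _ (by omega) l₂.length (by omega) l₁ (mem_words.2 ⟨rfl, h₁⟩) l₂
      (mem_words.2 ⟨rfl, h₂⟩)).resolve_right fun h => h.2 o (mem_ops.2 ho) hW
  · obtain ⟨e, he, hW'⟩ := (hshrink g hg l (mem_words.2 ⟨hlen, hl⟩)).resolve_left fun h => h hW
    exact ⟨l.take e, l[e], l.drop (e + 1), by simp, hW'⟩
  · have := hinit (n - 1) (by omega)
    rwa [Nat.sub_add_cancel hn] at this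

/-- All conditions of a certificate concern words of length at most `L` over finitely many colours,
so an arbitrary set `U` may be cut down to a finite list. -/
theorem safeCheck_of_certificate {P : DynProgram} {L : ℕ} {U : Config → Prop}
    (hL : ∀ R < P.auxAr.length, (P.initFormula R).code < L)
    (h : P.net.Certificate {c | c ∈ P.colors} {c | c ∈ P.colors} P.initColor P.initColor L U) :
    ∃ W, P.safeCheck (L, W) = true := by
  classical
  obtain ⟨W, hW⟩ : ∃ W : List Config, ∀ s, s ∈ W ↔
      (s.1 ∈ P.colors ∧ (∀ c ∈ s.2, c ∈ P.colors) ∧ s.2.length ≤ L) ∧ U s := by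
    refine ⟨(P.colors.flatMap fun g => (List.range (L + 1)).flatMap fun n =>
      (words P.colors n).map fun l => (g, l)).filter fun s => decide (U s), ?_⟩
    rintro ⟨g, l⟩
    simp only [List.mem_filter, List.mem_flatMap, List.mem_map, List.mem_range, mem_words,
      decide_eq_true_eq, Prod.mk.injEq]
    refine and_congr_left fun _ => ⟨?_, fun ⟨hg, hl, hlen⟩ =>
      ⟨g, hg, l.length, by omega, l, ⟨rfl, hl⟩, rfl, rfl⟩⟩
    rintro ⟨g, hg, n, hn, l, ⟨rfl, hl⟩, rfl, rfl⟩
    exact ⟨hg, hl, by omega⟩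
  have hcons : ∀ {a : Color} {l₁ l₂ : List Color}, a ∈ P.colors → (∀ c ∈ l₁, c ∈ P.colors) →
      (∀ c ∈ l₂, c ∈ P.colors) → ∀ c ∈ l₁ ++ a :: l₂, c ∈ P.colors := by
    intro a l₁ l₂ ha h₁ h₂ c hc
    simp only [List.mem_append, List.mem_cons] at hc
    rcases hc with hc | rfl | hc
    exacts [h₁ c hc, ha, h₂ c hc]
  refine ⟨W, ?_⟩
  simp only [safeCheck, goalCheck, closureCheck, stepCheck, shrinkCheck, initCheck,
    Bool.and_eq_true, List.all_eq_true, List.any_eq_true, Bool.or_eq_true, Bool.not_eq_true',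
    List.contains_eq_mem, decide_eq_true_eq, decide_eq_false_iff_not, List.mem_range]
  refine ⟨⟨fun g hg c hc => ?_, fun g hg a ha n hn m hm l₁ h₁ l₂ h₂ => ?_⟩,
    fun g hg l hl => ?_, ⟨h.pos, hL⟩, fun n hn hmem => ?_⟩
  · rw [or_iff_not_imp_left, Bool.not_eq_false, goalTest_eq_true_iff]
    exact fun hgc => (hW _).2 ⟨⟨hg, by simpa using hc, h.pos⟩, h.goal g hg c hc hgc⟩
  · obtain ⟨rfl, h₁'⟩ := mem_words.1 h₁
    obtain ⟨rfl, h₂'⟩ := mem_words.1 h₂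
    rw [or_iff_not_imp_left]
    intro hnot
    have hval := hcons ha h₁' h₂'
    have hlen : (l₁ ++ a :: l₂).length ≤ L := by simp; omega
    refine ⟨fun hmem => hnot ?_, fun o ho hmem => hnot ?_⟩
    · exact (hW _).2 ⟨⟨hg, hval, hlen⟩, h.up g hg a ha l₁ l₂ h₁' h₂' (by omega) ((hW _).1 hmem).2⟩
    · exact (hW _).2 ⟨⟨hg, hval, hlen⟩,
        h.step g hg a ha l₁ l₂ h₁' h₂' (by omega) o (mem_ops.1 ho) ((hW _).1 hmem).2⟩
  · obtain ⟨hlen, hl⟩ := mem_words.1 hl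
    rw [or_iff_not_imp_left, not_not]
    intro hmem
    obtain ⟨l₁, a, l₂, rfl, hU⟩ := h.shrink g hg l hl hlen ((hW _).1 hmem).2
    simp only [List.length_append, List.length_cons] at hlen
    refine ⟨l₁.length, by omega, (hW _).2 ⟨⟨hg, ?_, ?_⟩, ?_⟩⟩
    · intro c hc
      rcases List.mem_append.1 hc with hc | hc
      · exact hl c (List.mem_of_mem_take hc)
      · exact hl c (List.mem_of_mem_drop hc)
    · simp
      omega
    · simpa using hU
  · exact h.init (n + 1) n.succ_pos hn ((hW _).1 hmem).2

/-- `P` need not be well-formed: the net is defined for all raw data, which makes the two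
enumerations complementary on the whole input type. -/
theorem exists_safeCheck_iff (P : DynProgram) :
    (∃ p, P.safeCheck p = true) ↔ ∀ n, 0 < n → ¬ P.net.CanReachTarget (P.initConfig n) := by
  constructor
  · rintro ⟨⟨L, W⟩, h⟩ n hn
    obtain ⟨hL, hcert⟩ := certificate_of_safeCheck h
    exact hcert.not_canReach P.net_invariant P.initColor_mem P.initColor_mem
      (fun m hm => ⟨P.initColor_stable hcert.pos hL hm, P.initColor_stable hcert.pos hL hm⟩) hn
  · intro h
    -- `L` must exceed both the Higman bound and all codes of initialization formulas; the latter is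
    -- the role of `K + 1`.
    obtain ⟨K, hK⟩ := ((Set.finite_lt_nat P.auxAr.length).image
      fun R => (P.initFormula R).code).bddAbove
    obtain ⟨L, hL, hcert⟩ := TransferNet.exists_certificate (N := P.net)
      (List.finite_toSet P.colors) (List.finite_toSet P.colors) (K + 1) h
    obtain ⟨W, hW⟩ := safeCheck_of_certificate
      (fun R hR => lt_of_lt_of_le (Nat.lt_succ_of_le (hK ⟨R, hR, rfl⟩)) hL) hcert
    exact ⟨_, hW⟩

end DynProgram

end DynComplexity

theorem mainTheorem2 :
    ∃ decideEmpty : DynComplexity.DynProgram → Bool, Computable decideEmpty ∧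
      ∀ P : DynComplexity.DynProgram, P.IsDynProp 1 1 →
        (decideEmpty P = true ↔ P.IsEmpty) := by
  have hdec : ComputablePred fun P : DynComplexity.DynProgram => ∃ p, P.safeCheck p = true := by
    -- Post's theorem: one search looks for a certificate, the other for a run to the target.
    refine ComputablePred.computable_iff_re_compl_re'.2
      ⟨DynComplexity.rePred_exists DynComplexity.DynProgram.primrec_safeCheck,
        (DynComplexity.rePred_exists DynComplexity.DynProgram.primrec_reachCheck).of_eq
          fun P => ?_⟩
    rw [P.exists_reachCheck_iff, P.exists_safeCheck_iff]
    push Not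
    rfl
  obtain ⟨_, hcomp⟩ := hdec
  refine ⟨_, hcomp, fun P hP => ?_⟩
  rw [decide_eq_true_eq, DynComplexity.DynProgram.isEmpty_iff hP]
  exact P.exists_safeCheck_iff
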